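/- **Setting.** Let $H$ be a real Hilbert space with inner product $(\cdot,\cdot)$, and let $A:D(A)\subset H\to H$ be a closed, densely defined, self-adjoint, positive definite linear operator with compact resolvent. Let $\lambda_1\le\lambda_2\le\cdots$ be the infinite sequence of the eigenvalues of $A$, repeated according to multiplicity, with corresponding orthonormal eigenvectors $\phi_1,\phi_2,\dots$ (those with $\lambda_n=\Lambda$ span the eigenspace of $\Lambda$). Let $B\in\mathcal L(H)$, $\delta>0$, and $\beta'+\delta\beta=0$, $\beta(0)=1$, on $\mathbb R$ (so $\beta(t)=e^{-\delta t}$). On the complexification $\tilde H=H+iH$ (norm $|\cdot|_{\tilde H}$, with $A$ and $B$ extended complex-linearly) consider $$y'(t)+Ay(t)+\int_0^t\beta(t-s)Ay(s)\,ds=Bu(t),\qquad y(0)=y_0. \tag{1}$$ A weak solution of (1) is a $y\in C([0,\infty);\tilde H)$ with $y(0)=y_0$ such that for all $\varphi\in D(A)+iD(A)$ and $t\ge0$ $$\frac{d}{dt}(y(t),\varphi)+(y(t),A\varphi)+\int_0^t\beta(t-s)(y(s),A\varphi)\,ds=(Bu(t),\varphi);$$ a classical solution is a $y\in C^1([0,\infty);\tilde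 H)\cap C([0,\infty);D(A)+iD(A))$ satisfying (1) in $\tilde H$ for all $t\ge 0$. Put $\mu_n^\pm=\frac12\big(\lambda_n+\delta\pm\sqrt{(\lambda_n-\delta)^2-4\lambda_n}\big)\in\mathbb C$, and assume $\delta\ne\lambda_j\pm2\sqrt{\lambda_j}$ for all $j$ and $\mu_j^+\ne\mu_m^-$ for all $j\ne m$. Let $0<\gamma<\omega_0:=\delta+1$ and $$N=\max\big\{\sup\{j:\operatorname{Re}\mu_j^+\le\gamma\},\ \sup\{j:\operatorname{Re}\mu_j^-\le\gamma\}\big\}\quad(\sup\emptyset=0).$$ Let $\lambda_1,\dots,\lambda_N$ consist of $l$ distinct values, with multiplicities $m_1,\dots,m_l$, and let $M=\max_k m_k$ ($M=0$ if $N=0$). Let $\phi_1^*,\dots,\phi_N^*\in D(A)$ be eigenvectors of $A$, $A\phi_j^*=\lambda_j\phi_j^*$, with $(\phi_i,\phi_j^*)=\delta_{ij}$. Let $A_N=\mathrm{diag}(\lambda_j+\delta)_{j\le N}$, $B_N=\mathrm{diag}(\lambda_j(1+\delta))_{j\le N}$, $C_{NM}=\big((B\phi_i^*,\phi_j^*)\big)_{j\le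 N,\,i\le M}$, $$P_{2N}=\begin{pmatrix}0&I_N\\-B_N&-A_N\end{pmatrix},\qquad Q_{2NM}=\begin{pmatrix}0\\C_{NM}\end{pmatrix},\qquad D_{2N}=\mathrm{diag}(-\mu_1^+,\dots,-\mu_N^+,-\mu_1^-,\dots,-\mu_N^-).$$ Let $R_{2N}$ be an invertible complex matrix with $P_{2N}=R_{2N}^{-1}D_{2N}R_{2N}$, and $\overline Q_{2NM}=R_{2N}Q_{2NM}$. For $k=1,\dots,l$ let $\overline Q_k$ (resp. $\overline Q_{k+l}$) be the block of the $M\times 2N$ matrix $\overline Q_{2NM}^{\,*}$ formed by the columns $j$ (resp. $N+j$), $1\le j\le N$, for which $\lambda_j$ is the $k$-th distinct eigenvalue. **Theorem (semisimple case).** Assume that the eigenvalues $-\mu_j^\pm$, $1\le j\le N$, of $P_{2N}$ are semisimple and that $$\operatorname{rank}\overline Q_k=\operatorname{rank}\overline Q_{k+l}=m_k,\qquad k=1,\dots,l.$$ Consider controllers of the form $u(t)=\sum_{i=1}^M\Phi_iv_i(t)$ with $\Phi_i=\phi_i^*$ and $v=(v_i)_{i\le M}:[0,\infty)\to\mathbb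 C^M$. Say that $u$ *stabilizes (1) with constant $C$* if (1) has exactly one weak solution $y$ on $[0,\infty)$, this $y$ is a classical solution whenever $y_0\in D(A)+iD(A)$, and $$|y(t)|_{\tilde H}\le Ce^{-\gamma t}|y_0|_{\tilde H},\qquad t\ge0.$$ 1. There is $C>0$ such that for every $y_0\in\tilde H$ there is a continuous $v$ on $[0,\infty)$ whose controller $u$ stabilizes (1) with constant $C$. 2. For every $T>0$ there is $C>0$ such that for every $y_0\in\tilde H$ there are $v,w:[0,\infty)\to\mathbb C^M$, continuous on $[0,T)$, with $w\in L^2(0,T;\mathbb C^M)$ and, for $i=1,\dots,M$, $$v_i(t)=-\int_t^T\beta(t-s)w_i(s)\,ds\ \ (0\le t<T),\qquad \int_0^T|w_i(t)|^2dt\le C|y_0|_{\tilde H}^2,\qquad v_i(t)=w_i(t)=0\ \ (t\ge T),$$ such that the controller $u$ stabilizes (1) with constant $C$. 3. There is $C>0$ such that for every $y_0\in\tilde H$ there is $v\in C^2([0,\infty);\mathbb C^M)$ with $$|v_j(t)|+|v_j'(t)|+|v_j''(t)|\le Ce^{-\gamma t}|y_0|_{\tilde H},\qquad t>0,\ j=1,\dots,M,$$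 such that the controller $u$ stabilizes (1) with constant $C$. -/

import Mathlib

open scoped InnerProductSpace

set_option linter.unusedSectionVars false

noncomputable section

/-! ## The complexification `H + iH` of a real Hilbert space -/

/-- The complexification `H + iH` of a real inner product space `H`; the pair `(x, y)` stands for
`x + iy`, and `|x + iy|² = |x|² + |y|²`. -/
def Complexification (H : Type*) : Type _ := WithLp 2 (H × H)

namespace Complexification

variable {H : Type*} [NormedAddCommGroup H] [InnerProductSpace ℝ H]

instance : NormedAddCommGroup (Complexification H) :=
  inferInstanceAs (NormedAddCommGroup (WithLp 2 (H × H)))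

instance [CompleteSpace H] : CompleteSpace (Complexification H) :=
  inferInstanceAs (CompleteSpace (WithLp 2 (H × H)))

/-- The vector `x + iy`. -/
def mk (x y : H) : Complexification H := WithLp.toLp 2 (x, y)

/-- The real part of a vector of `H + iH`. -/
def re (z : Complexification H) : H := (WithLp.ofLp z).1

/-- The imaginary part of a vector of `H + iH`. -/
def im (z : Complexification H) : H := (WithLp.ofLp z).2

@[simp] theorem re_mk (x y : H) : (mk x y).re = x := rfl
@[simp] theorem im_mk (x y : H) : (mk x y).im = y := rfl

@[ext] theorem ext {z w : Complexification H} (h₁ : z.re = w.re) (h₂ : z.im = w.im) : z = w :=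
  (WithLp.ofLp_injective 2) (Prod.ext h₁ h₂)

@[simp] theorem re_add (z w : Complexification H) : (z + w).re = z.re + w.re := rfl
@[simp] theorem im_add (z w : Complexification H) : (z + w).im = z.im + w.im := rfl
@[simp] theorem re_zero : (0 : Complexification H).re = 0 := rfl
@[simp] theorem im_zero : (0 : Complexification H).im = 0 := rfl

theorem norm_sq_eq (z : Complexification H) : ‖z‖ ^ 2 = ‖z.re‖ ^ 2 + ‖z.im‖ ^ 2 :=
  WithLp.prod_norm_sq_eq_of_L2 (α := H) (β := H) z

/-- `(a + ib)(x + iy) = (ax - by) + i(ay + bx)`. -/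
instance : SMul ℂ (Complexification H) :=
  ⟨fun c z => mk (c.re • z.re - c.im • z.im) (c.re • z.im + c.im • z.re)⟩

@[simp] theorem re_smul (c : ℂ) (z : Complexification H) :
    (c • z).re = c.re • z.re - c.im • z.im := rfl
@[simp] theorem im_smul (c : ℂ) (z : Complexification H) :
    (c • z).im = c.re • z.im + c.im • z.re := rfl

instance : Module ℂ (Complexification H) where
  one_smul z := by ext <;> simp
  mul_smul a b z := by
    ext <;> simp only [re_smul, im_smul, Complex.mul_re, Complex.mul_im] <;> module
  smul_zero a := by ext <;> simp
  smul_add a z w := by ext <;> simp <;> module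
  add_smul a b z := by ext <;> simp <;> module
  zero_smul z := by ext <;> simp

/-- The inner product of `H + iH`, conjugate linear in the first argument (Mathlib's convention):
the sesquilinear extension of the inner product of `H`. -/
instance : Inner ℂ (Complexification H) :=
  ⟨fun z w => ⟨⟪z.re, w.re⟫_ℝ + ⟪z.im, w.im⟫_ℝ, ⟪z.re, w.im⟫_ℝ - ⟪z.im, w.re⟫_ℝ⟩⟩

theorem inner_def (z w : Complexification H) :
    ⟪z, w⟫_ℂ = ⟨⟪z.re, w.re⟫_ℝ + ⟪z.im, w.im⟫_ℝ, ⟪z.re, w.im⟫_ℝ - ⟪z.im, w.re⟫_ℝ⟩ := rfl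

theorem norm_smul_sq (c : ℂ) (z : Complexification H) : ‖c • z‖ ^ 2 = (‖c‖ * ‖z‖) ^ 2 := by
  rw [mul_pow, norm_sq_eq, norm_sq_eq, re_smul, im_smul, norm_sub_sq_real, norm_add_sq_real,
    Complex.sq_norm, Complex.normSq_apply]
  simp only [norm_smul, real_inner_smul_left, real_inner_smul_right, mul_pow, Real.norm_eq_abs,
    sq_abs]
  rw [real_inner_comm z.re z.im]
  ring

instance : InnerProductSpace ℂ (Complexification H) where
  norm_smul_le c z :=
    le_of_eq ((sq_eq_sq₀ (norm_nonneg _) (by positivity)).1 (norm_smul_sq c z))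
  norm_sq_eq_re_inner z := by
    rw [inner_def, norm_sq_eq]
    simp
  conj_inner_symm z w := by
    apply Complex.ext <;> simp [inner_def, real_inner_comm]
  add_left z w u := by
    apply Complex.ext <;> simp [inner_def, inner_add_left] <;> ring
  smul_left z w c := by
    apply Complex.ext <;>
      simp [inner_def, inner_add_left, inner_sub_left, real_inner_smul_left] <;> ring

/-- The inclusion `x ↦ x + i0` of `H` into `H + iH`. -/
def ofReal (x : H) : Complexification H := mk x 0

/-- The complex-linear extension `B (x + iy) = B x + i B y` of an operator on `H`. -/
def mapCLM (B : H →L[ℝ] H) (z : Complexification H) : Complexification H :=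
  mk (B z.re) (B z.im)

/-- The complex-linear extension of an unbounded operator `A` on `H`: its domain is
`D(A) + iD(A)` and `A (x + iy) = A x + i A y`. -/
def mapPMap (A : H →ₗ.[ℝ] H) : Complexification H →ₗ.[ℂ] Complexification H where
  domain :=
    { carrier := {z | z.re ∈ A.domain ∧ z.im ∈ A.domain}
      add_mem' := fun hz hw => ⟨A.domain.add_mem hz.1 hw.1, A.domain.add_mem hz.2 hw.2⟩
      zero_mem' := ⟨A.domain.zero_mem, A.domain.zero_mem⟩
      smul_mem' := fun c _ hz =>
        ⟨A.domain.sub_mem (A.domain.smul_mem c.re hz.1) (A.domain.smul_mem c.im hz.2),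
          A.domain.add_mem (A.domain.smul_mem c.re hz.2) (A.domain.smul_mem c.im hz.1)⟩ }
  toFun :=
    { toFun := fun z => mk (A ⟨z.1.re, z.2.1⟩) (A ⟨z.1.im, z.2.2⟩)
      map_add' := fun z w =>
        ext (A.map_add ⟨z.1.re, z.2.1⟩ ⟨w.1.re, w.2.1⟩)
          (A.map_add ⟨z.1.im, z.2.2⟩ ⟨w.1.im, w.2.2⟩)
      map_smul' := fun c z => by
        have h₁ := A.map_sub (c.re • ⟨z.1.re, z.2.1⟩) (c.im • ⟨z.1.im, z.2.2⟩)
        have h₂ := A.map_add (c.re • ⟨z.1.im, z.2.2⟩) (c.im • ⟨z.1.re, z.2.1⟩)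
        rw [A.map_smul, A.map_smul] at h₁ h₂
        exact ext h₁ h₂ }

end Complexification

namespace PIDE

open Complexification

variable {H : Type*} [NormedAddCommGroup H] [InnerProductSpace ℝ H]

/-! ## The operator `A` and its eigenvalues -/

/-- `A` is positive definite: `(Ax, x) > 0` for all `0 ≠ x ∈ D(A)`. -/
def PositiveDefinite (A : H →ₗ.[ℝ] H) : Prop :=
  ∀ x : A.domain, (x : H) ≠ 0 → 0 < ⟪A x, (x : H)⟫_ℝ

/-- For some `z` in the resolvent set of `A` the resolvent `(zI - A)⁻¹` is a compact operator. -/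
def HasCompactResolvent (A : H →ₗ.[ℝ] H) : Prop :=
  ∃ (z : ℝ) (K : H →L[ℝ] H), IsCompactOperator K ∧
    (∀ x : H, ∃ hx : K x ∈ A.domain, z • K x - A ⟨K x, hx⟩ = x) ∧
    ∀ x : A.domain, K (z • (x : H) - A x) = x

/-- `x` lies in `D(A)` and `A x = Λ x`. -/
def IsEigenpair (A : H →ₗ.[ℝ] H) (Λ : ℝ) (x : H) : Prop :=
  ∃ hx : x ∈ A.domain, A ⟨x, hx⟩ = Λ • x

/-- `lam 0 ≤ lam 1 ≤ …` lists the eigenvalues of `A`, each repeated according to its multiplicity,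
and `φ 0, φ 1, …` are corresponding orthonormal eigenvectors: the `φ n` with `lam n = Λ` span the
whole eigenspace of `Λ`. -/
structure IsEigenSystem (A : H →ₗ.[ℝ] H) (lam : ℕ → ℝ) (φ : ℕ → H) : Prop where
  mono : Monotone lam
  orthonormal : Orthonormal ℝ φ
  eigen : ∀ n, IsEigenpair A (lam n) (φ n)
  complete : ∀ (Λ : ℝ) (x : H), IsEigenpair A Λ x → x ∈ Submodule.span ℝ (φ '' {n | lam n = Λ})

/-! ## The exponents `μ_n^±` and the number `N` -/

/-- A square root of the real number `d` in `ℂ`: it is `√d` if `d ≥ 0`, and `i √|d|` if `d < 0`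
(recall that `Real.sqrt` vanishes on negative numbers). -/
def complexSqrt (d : ℝ) : ℂ := (Real.sqrt d : ℂ) + Complex.I * (Real.sqrt (-d) : ℂ)

/-- `μ^+ = (Λ + δ + √((Λ - δ)² - 4Λ)) / 2`. -/
def muPlus (δ Λ : ℝ) : ℂ := ((Λ + δ : ℝ) + complexSqrt ((Λ - δ) ^ 2 - 4 * Λ)) / 2

/-- `μ^- = (Λ + δ - √((Λ - δ)² - 4Λ)) / 2`. -/
def muMinus (δ Λ : ℝ) : ℂ := ((Λ + δ : ℝ) - complexSqrt ((Λ - δ) ^ 2 - 4 * Λ)) / 2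

/-- `N = max (sup {j : Re μ_j^+ ≤ γ}) (sup {j : Re μ_j^- ≤ γ})`, where the eigenvalues are numbered
from `1` on, i.e. the `j`-th one is `lam (j - 1)`; the supremum of the empty set is `0`. -/
def unstableDim (δ γ : ℝ) (lam : ℕ → ℝ) : ℕ :=
  max (sSup {n : ℕ | ∃ j : ℕ, n = j + 1 ∧ (muPlus δ (lam j)).re ≤ γ})
    (sSup {n : ℕ | ∃ j : ℕ, n = j + 1 ∧ (muMinus δ (lam j)).re ≤ γ})

/-- The multiplicity of `Λ` among the first `N` eigenvalues. -/
def mult (lam : ℕ → ℝ) (N : ℕ) (Λ : ℝ) : ℕ := Nat.card {j : Fin N // lam j = Λ}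

/-- `M`, the largest multiplicity among the first `N` eigenvalues (`0` if `N = 0`). -/
def maxMult (lam : ℕ → ℝ) (N : ℕ) : ℕ := Finset.univ.sup fun k : Fin N => mult lam N (lam k)

/-! ## The matrices of the finite-dimensional part -/

/-- `P_{2N} = [0, I; -B_N, -A_N]`, where `A_N = diag (λ_j + δ)` and `B_N = diag (λ_j (1 + δ))`. -/
def matP (δ : ℝ) (lam : ℕ → ℝ) (N : ℕ) : Matrix (Fin N ⊕ Fin N) (Fin N ⊕ Fin N) ℂ :=
  Matrix.fromBlocks 0 1
    (-Matrix.diagonal fun j : Fin N => ((lam j * (1 + δ) : ℝ) : ℂ))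
    (-Matrix.diagonal fun j : Fin N => ((lam j + δ : ℝ) : ℂ))

/-- `D_{2N} = diag (-μ_1^+, …, -μ_N^+, -μ_1^-, …, -μ_N^-)`. -/
def matD (δ : ℝ) (lam : ℕ → ℝ) (N : ℕ) : Matrix (Fin N ⊕ Fin N) (Fin N ⊕ Fin N) ℂ :=
  Matrix.diagonal (Sum.elim (fun j : Fin N => -muPlus δ (lam j)) fun j : Fin N => -muMinus δ (lam j))

/-- `C_{NM} = ((B φ_i^*, φ_j^*))`, with row index `j ≤ N` and column index `i ≤ M`. -/
def matC (B : H →L[ℝ] H) (φs : ℕ → H) (N M : ℕ) : Matrix (Fin N) (Fin M) ℂ :=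
  Matrix.of fun j i => ((⟪B (φs i), φs j⟫_ℝ : ℝ) : ℂ)

/-- `Q_{2NM} = [0; C_{NM}]`. -/
def matQ (B : H →L[ℝ] H) (φs : ℕ → H) (N M : ℕ) : Matrix (Fin N ⊕ Fin N) (Fin M) ℂ :=
  Matrix.fromRows 0 (matC B φs N M)

/-- The block of a matrix with column set `Fin N ⊕ Fin N` formed by those columns `j` of its first
half for which `lam j = Λ`. -/
def blockPlus {M N : ℕ} (Q : Matrix (Fin M) (Fin N ⊕ Fin N) ℂ) (lam : ℕ → ℝ) (Λ : ℝ) :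
    Matrix (Fin M) {j : Fin N // lam j = Λ} ℂ :=
  Q.submatrix id fun j => Sum.inl j.1

/-- The block of a matrix with column set `Fin N ⊕ Fin N` formed by those columns `j` of its second
half for which `lam j = Λ`. -/
def blockMinus {M N : ℕ} (Q : Matrix (Fin M) (Fin N ⊕ Fin N) ℂ) (lam : ℕ → ℝ) (Λ : ℝ) :
    Matrix (Fin M) {j : Fin N // lam j = Λ} ℂ :=
  Q.submatrix id fun j => Sum.inr j.1

open Classical in
/-- The rank condition: for each eigenvalue `Λ` among the first `N` ones, of multiplicity `m`, the
blocks of `Q̄^* = (R Q)^*` belonging to `-μ^+` and to `-μ^-` both have rank `m`. -/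
def RankCondition (B : H →L[ℝ] H) (lam : ℕ → ℝ) (φs : ℕ → H) (N M : ℕ)
    (R : Matrix (Fin N ⊕ Fin N) (Fin N ⊕ Fin N) ℂ) : Prop :=
  ∀ k : Fin N,
    (blockPlus (R * matQ B φs N M).conjTranspose lam (lam k)).rank = mult lam N (lam k) ∧
    (blockMinus (R * matQ B φs N M).conjTranspose lam (lam k)).rank = mult lam N (lam k)

/-- The number `ν` is semisimple for `P`: the generalized eigenspace of `ν` is its eigenspace. -/
def SemisimpleAt {ι : Type*} [Fintype ι] [DecidableEq ι] (P : Matrix ι ι ℂ) (ν : ℂ) : Prop :=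
  Module.End.maxGenEigenspace (Matrix.toLin' P) ν = Module.End.eigenspace (Matrix.toLin' P) ν

/-! ## Solutions of `y' + A y + ∫₀ᵗ β(t-s) A y(s) ds = B u`, `y(0) = y₀` in `H + iH` -/

/-- The control `u(t) = ∑ i, v_i(t) Φ_i` with complex amplitudes `v_i`. -/
def control {M : ℕ} (Φ : Fin M → H) (v : ℝ → Fin M → ℂ) (t : ℝ) : Complexification H :=
  ∑ i, v t i • ofReal (Φ i)

/-- Weak solutions for arbitrary initial data: `y ∈ C([0,∞); H + iH)`, `y(0) = y₀`, and
`d/dt (y, φ) + (y, Aφ) + ∫₀ᵗ β(t-s) (y(s), Aφ) ds = (Bu, φ)` for all `φ ∈ D(A) + iD(A)`, `t ≥ 0`. -/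
structure IsWeakSolution (A : H →ₗ.[ℝ] H) (B : H →L[ℝ] H) (β : ℝ → ℝ)
    (u : ℝ → Complexification H) (y₀ : Complexification H) (y : ℝ → Complexification H) :
    Prop where
  cont : ContinuousOn y (Set.Ici 0)
  init : y 0 = y₀
  eqn : ∀ φ : (mapPMap A).domain, ∀ t : ℝ, 0 ≤ t →
    HasDerivWithinAt (fun s => ⟪(φ : Complexification H), y s⟫_ℂ)
      (⟪(φ : Complexification H), mapCLM B (u t)⟫_ℂ - ⟪mapPMap A φ, y t⟫_ℂ
        - ∫ s in (0 : ℝ)..t, (β (t - s) : ℂ) * ⟪mapPMap A φ, y s⟫_ℂ)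
      (Set.Ici 0) t

/-- Classical solutions: `y ∈ C¹([0,∞); H + iH) ∩ C([0,∞); D(A) + iD(A))` (the latter with the graph
norm), `y(0) = y₀`, and the equation holds in `H + iH` at every `t ≥ 0`. Here `z = A y`. -/
def IsClassicalSolution (A : H →ₗ.[ℝ] H) (B : H →L[ℝ] H) (β : ℝ → ℝ)
    (u : ℝ → Complexification H) (y₀ : Complexification H) (y : ℝ → Complexification H) : Prop :=
  y 0 = y₀ ∧ ContDiffOn ℝ 1 y (Set.Ici 0) ∧
    ∃ z : ℝ → Complexification H, ContinuousOn z (Set.Ici 0) ∧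
      ∀ t : ℝ, 0 ≤ t → (∃ ht : y t ∈ (mapPMap A).domain, z t = mapPMap A ⟨y t, ht⟩) ∧
        HasDerivWithinAt y
          (mapCLM B (u t) - z t - ∫ s in (0 : ℝ)..t, β (t - s) • z s) (Set.Ici 0) t

/-- The control `u` takes the initial state `y₀` to a trajectory that decays at the rate `γ`: the
equation has exactly one weak solution `y` on `[0,∞)`, it satisfies `|y(t)| ≤ C e^{-γt} |y₀|` for
`t ≥ 0`, and it is a classical solution if `y₀ ∈ D(A) + iD(A)`. -/
def Steers (A : H →ₗ.[ℝ] H) (B : H →L[ℝ] H) (β : ℝ → ℝ) (γ C : ℝ)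
    (y₀ : Complexification H) (u : ℝ → Complexification H) : Prop :=
  ∃ y : ℝ → Complexification H,
    IsWeakSolution A B β u y₀ y ∧
    (∀ y', IsWeakSolution A B β u y₀ y' → Set.EqOn y' y (Set.Ici 0)) ∧
    (y₀ ∈ (mapPMap A).domain → IsClassicalSolution A B β u y₀ y) ∧
    ∀ t : ℝ, 0 ≤ t → ‖y t‖ ≤ C * Real.exp (-γ * t) * ‖y₀‖

end PIDE

end

open PIDE

noncomputable section

namespace PIDE

open Complexification
open scoped ContDiff

/-! ### Spectral theory of `A` and the eigenbasis of `H + iH`. -/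

section Operator

variable {H : Type*} [NormedAddCommGroup H] [InnerProductSpace ℝ H] [CompleteSpace H]
  {A : H →ₗ.[ℝ] H} {lam : ℕ → ℝ} {φ : ℕ → H}

/-! In the eigenbasis of `A` the equation decouples. The component `y_n` and its memory `z_n` solve
the planar system `y' = f - λy - λz`, `z' = y - δz`, whose exponents `-μ` satisfy `μ(μ - δ) = λ(μ -
1 - δ)`, that is, `μ = μ_n^±`. The roots are distinct by assumption, so `y_n` is a combination of
two Duhamel integrals (`mode`). Since `Re μ_n^- ≥ 1 + δ > γ` for large `λ_n`, every mode with `n ≥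
N` already has both exponents beyond `γ`, and a force supported in `(0, T)` does not spoil its
decay.

The remaining modes are brought exactly to rest at time `T`. With `a_n` the component of `y₀`, this
holds as soon as `a_n + ∫₀ᵀ e^{μs} f_n(s) ds = 0` for both roots `μ`. These finitely many moment
equations are solvable for two reasons. A root determines its eigenvalue (`eq_of_quadratic`), so
different eigenvalues have disjoint sets of exponents, and moments against distinct exponentials can
be prescribed by functions in `C_c^∞(0, T)` (`exists_contDiff_integral_cexp`). Within one
eigenvalue, the rank condition makes the corresponding rows of `C_{NM}` independent, so amplitude
vectors `U_j` address its modes one by one (`RankCondition.exists_mulVec_eq`). The control is `v =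
-∑ a_j θ_j U_j`, linear in `y₀`, whence the uniform constants.

`steers_of_moments` turns the moment equations into existence, uniqueness, regularity and decay of
the solution, and `exists_smooth_control` constructs `v`. This single smooth, compactly supported
control serves all three claims; in the second one `w = v' + δv`. -/

theorem inner_map_comm (hA : IsSelfAdjoint A) (x y : A.domain) :
    ⟪A x, (y : H)⟫_ℝ = ⟪(x : H), A y⟫_ℝ := by
  have h := LinearPMap.adjoint_isFormalAdjoint (T := A) hA.dense_domain
  rw [LinearPMap.isSelfAdjoint_def.1 hA] at h
  exact h x y

theorem mem_domain_of_inner (hA : IsSelfAdjoint A) {x z : H}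
    (h : ∀ y : A.domain, ⟪z, (y : H)⟫_ℝ = ⟪x, A y⟫_ℝ) : ∃ hx : x ∈ A.domain, A ⟨x, hx⟩ = z := by
  -- A variable `T` in place of `A` lets the adjoint be substituted inside the dependent membership
  -- proof.
  have key : ∀ T : H →ₗ.[ℝ] H, T = A.adjoint → ∃ hx : x ∈ T.domain, T ⟨x, hx⟩ = z := by
    rintro T rfl
    exact ⟨LinearPMap.mem_adjoint_domain_of_exists x ⟨z, h⟩,
      LinearPMap.adjoint_apply_eq hA.dense_domain ⟨x, _⟩ h⟩
  exact key A (LinearPMap.isSelfAdjoint_def.1 hA).symm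

theorem IsEigenSystem.inner_map (hφ : IsEigenSystem A lam φ) (hA : IsSelfAdjoint A)
    (x : A.domain) (n : ℕ) : ⟪φ n, A x⟫_ℝ = lam n * ⟪φ n, (x : H)⟫_ℝ := by
  obtain ⟨h, h'⟩ := hφ.eigen n
  have := inner_map_comm hA ⟨φ n, h⟩ x
  rw [h', real_inner_smul_left] at this
  exact this.symm

theorem IsEigenSystem.pos (hφ : IsEigenSystem A lam φ) (hpos : PositiveDefinite A) (n : ℕ) :
    0 < lam n := by
  obtain ⟨h, h'⟩ := hφ.eigen n
  have := hpos ⟨φ n, h⟩ (hφ.orthonormal.ne_zero n)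
  rwa [h', real_inner_smul_left, real_inner_self_eq_norm_sq, hφ.orthonormal.1 n, one_pow,
    mul_one] at this

/-- If the eigenvalues stayed bounded, the vectors `K φ_n = (z - λ_n)⁻¹ φ_n` would be orthogonal
with norms bounded below, so no subsequence could be Cauchy, against compactness of `K`. -/
theorem IsEigenSystem.tendsto (hφ : IsEigenSystem A lam φ) (hcpt : HasCompactResolvent A) :
    Filter.Tendsto lam Filter.atTop Filter.atTop := by
  obtain ⟨z, K, hK, -, hK2⟩ := hcpt
  refine Filter.tendsto_atTop_atTop_of_monotone hφ.mono ?_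
  by_contra! hbd
  obtain ⟨b, hb⟩ := hbd
  have hKφ (n : ℕ) : (z - lam n) • K (φ n) = φ n := by
    obtain ⟨h, h'⟩ := hφ.eigen n
    have := hK2 ⟨φ n, h⟩
    rwa [h', ← sub_smul, map_smul] at this
  set c := |z| + |b| + |lam 0| + 1 with hc
  have hcpos : 0 < c := by positivity
  have hle (n : ℕ) : |z - lam n| ≤ c := by
    have h0 := hφ.mono (Nat.zero_le n)
    have h1 := hb n
    rw [abs_le]
    constructor <;>
    linarith [neg_abs_le z, le_abs_self z, neg_abs_le b, le_abs_self b, neg_abs_le (lam 0),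
      le_abs_self (lam 0), abs_nonneg (lam 0), abs_nonneg b]
  have hcomp := hK.isCompact_closure_image_closedBall (1 : ℝ)
  obtain ⟨a, -, s, hs, hlim⟩ := hcomp.tendsto_subseq (x := fun n => K (φ n)) fun n =>
    subset_closure ⟨φ n, by simp [hφ.orthonormal.1 n], rfl⟩
  have hcau := hlim.cauchySeq
  rw [Metric.cauchySeq_iff'] at hcau
  obtain ⟨n, hn⟩ := hcau (1 / c) (by positivity)
  have h1 := hn (n + 1) (Nat.le_succ n)
  simp only [Function.comp, dist_eq_norm] at h1
  set p := s (n + 1)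
  set q := s n
  have hpq : p ≠ q := (hs (Nat.lt_succ_self n)).ne'
  have horth : ⟪φ p, K (φ q)⟫_ℝ = 0 := by
    have : ⟪φ p, φ q⟫_ℝ = 0 := hφ.orthonormal.2 hpq
    have hq := hKφ q
    by_cases h0 : z - lam q = 0
    · rw [h0, zero_smul] at hq
      exact absurd hq.symm (hφ.orthonormal.ne_zero q)
    · rw [← hq, real_inner_smul_right] at this
      exact (mul_eq_zero.1 this).resolve_left h0
  have hone : (z - lam p) * ⟪φ p, K (φ p) - K (φ q)⟫_ℝ = 1 := by
    rw [inner_sub_right, horth, sub_zero, ← real_inner_smul_right, hKφ,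
      real_inner_self_eq_norm_sq, hφ.orthonormal.1 p, one_pow]
  have hcs : |⟪φ p, K (φ p) - K (φ q)⟫_ℝ| ≤ ‖K (φ p) - K (φ q)‖ := by
    simpa [hφ.orthonormal.1 p] using abs_real_inner_le_norm (φ p) (K (φ p) - K (φ q))
  have : (1 : ℝ) ≤ c * ‖K (φ p) - K (φ q)‖ := by
    rw [← abs_one, ← hone, abs_mul]
    exact mul_le_mul (hle p) hcs (abs_nonneg _) hcpos.le
  have h2 := mul_lt_mul_of_pos_left h1 hcpos
  rw [mul_one_div_cancel hcpos.ne'] at h2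
  linarith

/-- The spectral theorem for the compact symmetric resolvent `K` applies: an eigenvector of `K` for
`κ ≠ 0` is one of `A` for `z - κ⁻¹`, and `κ = 0` is excluded because `K` is injective. -/
theorem IsEigenSystem.orthogonal_eq_bot (hφ : IsEigenSystem A lam φ) (hA : IsSelfAdjoint A)
    (hcpt : HasCompactResolvent A) : (Submodule.span ℝ (Set.range φ))ᗮ = ⊥ := by
  obtain ⟨z, K, hK, hK1, hK2⟩ := hcpt
  have hsymm : (K : H →ₗ[ℝ] H).IsSymmetric := by
    intro x y
    obtain ⟨hx, hx'⟩ := hK1 x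
    obtain ⟨hy, hy'⟩ := hK1 y
    have := inner_map_comm hA ⟨K x, hx⟩ ⟨K y, hy⟩
    change ⟪K x, y⟫_ℝ = ⟪x, K y⟫_ℝ
    conv_lhs => rw [← hy']
    conv_rhs => rw [← hx']
    rw [inner_sub_right, inner_sub_left, real_inner_smul_left, real_inner_smul_right, this]
  have hbot := ContinuousLinearMap.orthogonalComplement_iSup_eigenspaces_eq_bot (T := K) hK hsymm
  rw [eq_bot_iff, ← hbot]
  refine Submodule.orthogonal_le (iSup_le fun κ => ?_)
  intro x hx
  rw [Module.End.mem_eigenspace_iff] at hx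
  change K x = κ • x at hx
  obtain ⟨hd, he⟩ := hK1 x
  by_cases hκ : κ = 0
  · have : A ⟨K x, hd⟩ = 0 := by
      have h0 : (⟨K x, hd⟩ : A.domain) = 0 := Subtype.ext (by simp [hx, hκ])
      rw [h0, A.map_zero]
    rw [this, hx, hκ] at he
    simp only [zero_smul, smul_zero, sub_zero] at he
    rw [← he]; exact Submodule.zero_mem _
  · have hxd : x ∈ A.domain := by
      have := A.domain.smul_mem κ⁻¹ hd
      rwa [hx, smul_smul, inv_mul_cancel₀ hκ, one_smul] at this
    have h1 : (⟨K x, hd⟩ : A.domain) = κ • ⟨x, hxd⟩ := Subtype.ext hx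
    rw [h1, A.map_smul, hx] at he
    have hpair : IsEigenpair A (z - κ⁻¹) x := by
      refine ⟨hxd, ?_⟩
      have h2 : κ • A ⟨x, hxd⟩ = z • κ • x - x := by rw [eq_sub_iff_add_eq, ← eq_sub_iff_add_eq', he]
      rw [← inv_smul_smul₀ hκ (A ⟨x, hxd⟩), h2, smul_sub, smul_comm z κ, inv_smul_smul₀ hκ, sub_smul]
    exact Submodule.span_mono (Set.image_subset_range _ _) (hφ.complete _ x hpair)

/-- The eigenvectors of `A` as a Hilbert basis of `H`. -/
def IsEigenSystem.basis (hφ : IsEigenSystem A lam φ) (hA : IsSelfAdjoint A)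
    (hcpt : HasCompactResolvent A) : HilbertBasis ℕ ℝ H :=
  HilbertBasis.mkOfOrthogonalEqBot hφ.orthonormal (hφ.orthogonal_eq_bot hA hcpt)

@[simp] theorem IsEigenSystem.coe_basis (hφ : IsEigenSystem A lam φ) (hA : IsSelfAdjoint A)
    (hcpt : HasCompactResolvent A) : ⇑(hφ.basis hA hcpt) = φ :=
  HilbertBasis.coe_mkOfOrthogonalEqBot _ _

/-- By Parseval `(z, y) = (x, Ay)` for every `y ∈ D(A)`, which puts `x` in the domain of the
adjoint, that is, of `A`. -/
theorem IsEigenSystem.mem_domain (hφ : IsEigenSystem A lam φ) (hA : IsSelfAdjoint A)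
    (hcpt : HasCompactResolvent A) {x z : H} (h : ∀ n, ⟪φ n, z⟫_ℝ = lam n * ⟪φ n, x⟫_ℝ) :
    ∃ hx : x ∈ A.domain, A ⟨x, hx⟩ = z := by
  refine mem_domain_of_inner hA fun y => ?_
  rw [← (hφ.basis hA hcpt).tsum_inner_mul_inner z y, ← (hφ.basis hA hcpt).tsum_inner_mul_inner x]
  refine tsum_congr fun n => ?_
  rw [hφ.coe_basis, hφ.inner_map hA, real_inner_comm, h, real_inner_comm x]
  ring

/-! ### The complexified eigenvectors -/

theorem inner_ofReal (x : H) (z : Complexification H) :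
    ⟪ofReal x, z⟫_ℂ = ⟨⟪x, z.re⟫_ℝ, ⟪x, z.im⟫_ℝ⟩ := by
  simp [inner_def, ofReal]

theorem orthonormal_ofReal (hφ : Orthonormal ℝ φ) : Orthonormal ℂ fun n => ofReal (φ n) := by
  rw [orthonormal_iff_ite] at hφ ⊢
  intro i j
  rw [inner_ofReal]
  apply Complex.ext <;> simp [ofReal, hφ] <;> split_ifs <;> simp

theorem IsEigenSystem.orthogonal_ofReal_eq_bot (hφ : IsEigenSystem A lam φ)
    (hA : IsSelfAdjoint A) (hcpt : HasCompactResolvent A) :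
    (Submodule.span ℂ (Set.range fun n => ofReal (φ n)))ᗮ = ⊥ := by
  rw [eq_bot_iff]
  intro z hz
  have hzero {x : H} (h : ∀ n, ⟪φ n, x⟫_ℝ = 0) : x = 0 := by
    have := hφ.orthogonal_eq_bot hA hcpt
    rw [Submodule.eq_bot_iff] at this
    refine this x ((Submodule.mem_orthogonal _ _).2 fun u hu => ?_)
    induction hu using Submodule.span_induction with
    | mem x hx => obtain ⟨n, rfl⟩ := hx; exact h n
    | zero => simp
    | add x y _ _ hx hy => rw [inner_add_left, hx, hy, add_zero]
    | smul a x _ hx => rw [real_inner_smul_left, hx, mul_zero]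
  have hn (n : ℕ) : ⟪ofReal (φ n), z⟫_ℂ = 0 :=
    (Submodule.mem_orthogonal _ _).1 hz _ (Submodule.subset_span ⟨n, rfl⟩)
  simp only [inner_ofReal] at hn
  rw [Submodule.mem_bot]
  exact Complexification.ext (hzero fun n => congrArg Complex.re (hn n))
    (hzero fun n => congrArg Complex.im (hn n))

/-- The eigenvectors of `A` as a Hilbert basis of `H + iH`. -/
def IsEigenSystem.basisC (hφ : IsEigenSystem A lam φ) (hA : IsSelfAdjoint A)
    (hcpt : HasCompactResolvent A) : HilbertBasis ℕ ℂ (Complexification H) :=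
  HilbertBasis.mkOfOrthogonalEqBot (orthonormal_ofReal hφ.orthonormal)
    (hφ.orthogonal_ofReal_eq_bot hA hcpt)

theorem IsEigenSystem.coe_basisC (hφ : IsEigenSystem A lam φ) (hA : IsSelfAdjoint A)
    (hcpt : HasCompactResolvent A) (n : ℕ) : hφ.basisC hA hcpt n = ofReal (φ n) :=
  congrFun (HilbertBasis.coe_mkOfOrthogonalEqBot _ _) n

theorem IsEigenSystem.ofReal_mem_domain (hφ : IsEigenSystem A lam φ) (n : ℕ) :
    ∃ h : ofReal (φ n) ∈ (mapPMap A).domain,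
      mapPMap A ⟨ofReal (φ n), h⟩ = (lam n : ℂ) • ofReal (φ n) := by
  obtain ⟨h, h'⟩ := hφ.eigen n
  refine ⟨⟨h, A.domain.zero_mem⟩, Complexification.ext ?_ ?_⟩
  · exact h'.trans (by simp [ofReal, -Complex.coe_smul])
  · exact (A.map_zero).trans (by simp [ofReal, -Complex.coe_smul])

theorem IsEigenSystem.inner_mapPMap (hφ : IsEigenSystem A lam φ) (hA : IsSelfAdjoint A)
    (x : (mapPMap A).domain) (n : ℕ) :
    ⟪ofReal (φ n), mapPMap A x⟫_ℂ = lam n * ⟪ofReal (φ n), (x : Complexification H)⟫_ℂ := by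
  rw [inner_ofReal, inner_ofReal]
  apply Complex.ext
  · exact (hφ.inner_map hA ⟨x.1.re, x.2.1⟩ n).trans (by simp)
  · exact (hφ.inner_map hA ⟨x.1.im, x.2.2⟩ n).trans (by simp)

theorem IsEigenSystem.mem_mapPMap_domain (hφ : IsEigenSystem A lam φ) (hA : IsSelfAdjoint A)
    (hcpt : HasCompactResolvent A) {x z : Complexification H}
    (h : ∀ n, ⟪ofReal (φ n), z⟫_ℂ = lam n * ⟪ofReal (φ n), x⟫_ℂ) :
    ∃ hx : x ∈ (mapPMap A).domain, z = mapPMap A ⟨x, hx⟩ := by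
  simp only [inner_ofReal, Complex.ext_iff, Complex.mul_re, Complex.mul_im, Complex.ofReal_re,
    Complex.ofReal_im, zero_mul, sub_zero, add_zero] at h
  obtain ⟨h1, h1'⟩ := hφ.mem_domain hA hcpt fun n => (h n).1
  obtain ⟨h2, h2'⟩ := hφ.mem_domain hA hcpt fun n => (h n).2
  exact ⟨⟨h1, h2⟩, Complexification.ext h1'.symm h2'.symm⟩

end Operator

/-! ### Moments of test functions against exponentials. -/

section Exponentials

theorem hasDerivAt_cexp_mul (ν : ℂ) (t : ℝ) :
    HasDerivAt (fun s : ℝ => Complex.exp (ν * s)) (ν * Complex.exp (ν * t)) t := by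
  have h : HasDerivAt (fun s : ℝ => ν * (s : ℂ)) (ν * 1) t :=
    (Complex.ofRealCLM.hasDerivAt (x := t)).const_mul ν
  simpa [mul_comm] using h.cexp

theorem eq_zero_of_tsupport_subset_Ioo {θ : ℝ → ℂ} {a b t : ℝ} (h : tsupport θ ⊆ Set.Ioo a b)
    (ht : t ∉ Set.Ioo a b) : θ t = 0 :=
  image_eq_zero_of_notMem_tsupport fun h' => ht (h h')

/-- Integration by parts: `d/ds + a` multiplies the moment at `ν` by `a - ν`, so it annihilates the
moment at `a` and preserves vanishing moments and supports. -/
theorem integral_cexp_mul_deriv_add {θ : ℝ → ℂ} {T : ℝ} (hθ : ContDiff ℝ ∞ θ)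
    (hs : tsupport θ ⊆ Set.Ioo 0 T) (a ν : ℂ) :
    ∫ s in (0 : ℝ)..T, Complex.exp (ν * s) * (deriv θ s + a * θ s)
      = (a - ν) * ∫ s in (0 : ℝ)..T, Complex.exp (ν * s) * θ s := by
  have hc : Continuous θ := hθ.continuous
  have hc' : Continuous (deriv θ) := hθ.continuous_deriv (by simp)
  have hd (s : ℝ) : HasDerivAt θ (deriv θ s) s := (hθ.differentiable (by simp) s).hasDerivAt
  have key : ∫ s in (0 : ℝ)..T,
      (ν * Complex.exp (ν * s) * θ s + Complex.exp (ν * s) * deriv θ s) = 0 := by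
    rw [intervalIntegral.integral_eq_sub_of_hasDerivAt
      (f := fun s : ℝ => Complex.exp (ν * s) * θ s)
      (fun s _ => (hasDerivAt_cexp_mul ν s).mul (hd s))
      (Continuous.intervalIntegrable (by fun_prop) _ _),
      eq_zero_of_tsupport_subset_Ioo hs (by simp), eq_zero_of_tsupport_subset_Ioo hs (by simp)]
    simp
  have hsum : ∀ s : ℝ, Complex.exp (ν * s) * (deriv θ s + a * θ s)
      = (ν * Complex.exp (ν * s) * θ s + Complex.exp (ν * s) * deriv θ s)
        + (a - ν) * (Complex.exp (ν * s) * θ s) := fun s => by ring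
  simp_rw [hsum]
  rw [intervalIntegral.integral_add (Continuous.intervalIntegrable (by fun_prop) _ _)
    (Continuous.intervalIntegrable (by fun_prop) _ _), key, zero_add,
    intervalIntegral.integral_const_mul]

theorem exists_contDiff_integral_cexp_eq_one {T : ℝ} (hT : 0 < T) (ν : ℂ) :
    ∃ θ : ℝ → ℂ, ContDiff ℝ ∞ θ ∧ tsupport θ ⊆ Set.Ioo 0 T ∧
      ∫ s in (0 : ℝ)..T, Complex.exp (ν * s) * θ s = 1 := by
  let ρ : ContDiffBump (T / 2) := ⟨T / 5, T / 4, by positivity, by linarith⟩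
  have hcont : Continuous fun s => ρ s := ρ.continuous
  have hpos : 0 < ∫ s in (0 : ℝ)..T, ρ s := by
    refine intervalIntegral.integral_pos hT hcont.continuousOn (fun s _ => ρ.nonneg)
      ⟨T / 2, by constructor <;> linarith, ρ.pos_of_mem_ball ?_⟩
    exact Metric.mem_ball_self (by change 0 < T / 4; positivity)
  set I : ℝ := ∫ s in (0 : ℝ)..T, ρ s
  refine ⟨fun s => ((ρ s : ℝ) : ℂ) * (Complex.exp (-ν * s) / I), ?_, ?_, ?_⟩
  · have h1 : ContDiff ℝ ∞ fun s => ((ρ s : ℝ) : ℂ) := Complex.ofRealCLM.contDiff.comp ρ.contDiff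
    have h2 : ContDiff ℝ ∞ fun s : ℝ => Complex.exp (-ν * s) :=
      (contDiff_const.mul Complex.ofRealCLM.contDiff).cexp
    exact h1.mul (h2.div_const _)
  · refine (tsupport_mul_subset_left (f := fun s => ((ρ s : ℝ) : ℂ))).trans ?_
    have h3 : tsupport (fun s => ((ρ s : ℝ) : ℂ)) ⊆ tsupport ρ :=
      closure_mono fun s hs h0 => hs (by simp [h0])
    refine h3.trans ?_
    rw [ρ.tsupport_eq, Real.closedBall_eq_Icc]
    rintro s ⟨h1, h2⟩
    change T / 2 - T / 4 ≤ s at h1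
    change s ≤ T / 2 + T / 4 at h2
    constructor <;> linarith
  · have : ∀ s : ℝ, Complex.exp (ν * s) * (((ρ s : ℝ) : ℂ) * (Complex.exp (-ν * s) / I))
        = ((ρ s / I : ℝ) : ℂ) := fun s => by
      rw [neg_mul, Complex.exp_neg]
      push_cast
      field_simp [Complex.exp_ne_zero]
    simp_rw [this]
    rw [intervalIntegral.integral_ofReal, intervalIntegral.integral_div, div_self hpos.ne',
      Complex.ofReal_one]

theorem tsupport_deriv_add_subset {θ : ℝ → ℂ} {S : Set ℝ} (h : tsupport θ ⊆ S) (a : ℂ) :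
    tsupport (fun s => deriv θ s + a * θ s) ⊆ S := by
  refine (closure_minimal (fun s hs => ?_) (isClosed_tsupport θ)).trans h
  by_contra h0
  refine hs (show deriv θ s + a * θ s = 0 from ?_)
  rw [image_eq_zero_of_notMem_tsupport h0,
    image_eq_zero_of_notMem_tsupport fun h' => h0 (tsupport_deriv_subset h'), mul_zero, add_zero]

/-- Each new exponent `a` is handled by applying `(a - ν)⁻¹ (d/ds + a)`, which kills the moment at
`a`, keeps the value `1` at `ν`, and keeps the zeros already obtained. -/
theorem exists_contDiff_biorthogonal {T : ℝ} (hT : 0 < T) (ν : ℂ) (E : Finset ℂ) (hν : ν ∉ E) :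
    ∃ θ : ℝ → ℂ, ContDiff ℝ ∞ θ ∧ tsupport θ ⊆ Set.Ioo 0 T ∧
      ∫ s in (0 : ℝ)..T, Complex.exp (ν * s) * θ s = 1 ∧
      ∀ ν' ∈ E, ∫ s in (0 : ℝ)..T, Complex.exp (ν' * s) * θ s = 0 := by
  induction E using Finset.induction_on with
  | empty =>
    obtain ⟨θ, h1, h2, h3⟩ := exists_contDiff_integral_cexp_eq_one hT ν
    exact ⟨θ, h1, h2, h3, by simp⟩
  | insert a E ha ih =>
    rw [Finset.mem_insert, not_or] at hν
    obtain ⟨θ, h1, h2, h3, h4⟩ := ih hν.2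
    have hne : a - ν ≠ 0 := sub_ne_zero.2 (Ne.symm hν.1)
    have hI (z : ℂ) : ∫ s in (0 : ℝ)..T, Complex.exp (z * s) * ((a - ν)⁻¹ * (deriv θ s + a * θ s))
        = (a - ν)⁻¹ * ((a - z) * ∫ s in (0 : ℝ)..T, Complex.exp (z * s) * θ s) := by
      rw [← integral_cexp_mul_deriv_add h1 h2, ← intervalIntegral.integral_const_mul]
      congr 1; ext s; ring
    refine ⟨fun s => (a - ν)⁻¹ * (deriv θ s + a * θ s), ?_, ?_, ?_, ?_⟩
    · have : ContDiff ℝ ∞ (deriv θ) := ((contDiff_infty_iff_deriv).1 h1).2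
      exact contDiff_const.mul (this.add (contDiff_const.mul h1))
    · exact (tsupport_mul_subset_right (f := fun _ => (a - ν)⁻¹)).trans
        (tsupport_deriv_add_subset h2 a)
    · rw [hI, h3, mul_one, inv_mul_cancel₀ hne]
    · intro ν' hν'
      rw [hI]
      rcases Finset.mem_insert.1 hν' with rfl | h
      · simp
      · simp [h4 ν' h]

/-- The moments of a smooth function with compact support in `(0, T)` against finitely many
exponentials can be prescribed. -/
theorem exists_contDiff_integral_cexp {T : ℝ} (hT : 0 < T) (E : Finset ℂ) (p : ℂ → ℂ) :
    ∃ θ : ℝ → ℂ, ContDiff ℝ ∞ θ ∧ tsupport θ ⊆ Set.Ioo 0 T ∧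
      ∀ ν ∈ E, ∫ s in (0 : ℝ)..T, Complex.exp (ν * s) * θ s = p ν := by
  choose θ h1 h2 h3 h4 using fun ν : ℂ =>
    exists_contDiff_biorthogonal hT ν (E.erase ν) (Finset.notMem_erase ν E)
  refine ⟨fun s => ∑ ν ∈ E, p ν * θ ν s, ContDiff.sum fun ν _ => contDiff_const.mul (h1 ν), ?_, ?_⟩
  · refine (closure_minimal (t := ⋃ ν ∈ E, tsupport (θ ν)) (fun s hs => ?_)
      (isClosed_biUnion_finset fun ν _ => isClosed_tsupport _)).trans
      (Set.iUnion₂_subset fun ν _ => h2 ν)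
    obtain ⟨ν, hν, h⟩ := Finset.exists_ne_zero_of_sum_ne_zero hs
    exact Set.mem_biUnion hν (subset_tsupport _ (right_ne_zero_of_mul h))
  · intro ν hν
    have hc (z : ℂ) : Continuous (θ z) := (h1 z).continuous
    simp_rw [Finset.mul_sum]
    rw [intervalIntegral.integral_finsetSum fun z _ =>
      Continuous.intervalIntegrable (by fun_prop) _ _]
    rw [Finset.sum_eq_single ν]
    · simp_rw [mul_left_comm _ (p ν)]
      rw [intervalIntegral.integral_const_mul, h3, mul_one]
    · intro z _ hz
      simp_rw [mul_left_comm _ (p z)]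
      rw [intervalIntegral.integral_const_mul, h4 z ν (Finset.mem_erase.2 ⟨hz.symm, hν⟩), mul_zero]
    · exact fun h => absurd hν h

end Exponentials

/-! ### The exponents `μ^±`, their asymptotics and the index `N`. -/

section Exponents

theorem complexSqrt_mul_self (d : ℝ) : complexSqrt d * complexSqrt d = d := by
  unfold complexSqrt
  rcases le_total 0 d with h | h
  · rw [Real.sqrt_eq_zero_of_nonpos (neg_nonpos.2 h)]
    simp [← Complex.ofReal_mul, Real.mul_self_sqrt h]
  · rw [Real.sqrt_eq_zero_of_nonpos h]
    have := Real.mul_self_sqrt (neg_nonneg.2 h)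
    calc _ = Complex.I * Complex.I * ((√(-d) * √(-d) : ℝ) : ℂ) := by push_cast; ring
      _ = d := by rw [this, Complex.I_mul_I]; push_cast; ring

/-- The characteristic equation is written linearly in `Λ`, so that it can be solved for `Λ` in
terms of `μ`. -/
theorem muPlus_quadratic (δ Λ : ℝ) :
    muPlus δ Λ * (muPlus δ Λ - δ) = Λ * (muPlus δ Λ - 1 - δ) := by
  have h := complexSqrt_mul_self ((Λ - δ) ^ 2 - 4 * Λ)
  unfold muPlus
  push_cast at h ⊢
  linear_combination h / 4

theorem muMinus_quadratic (δ Λ : ℝ) :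
    muMinus δ Λ * (muMinus δ Λ - δ) = Λ * (muMinus δ Λ - 1 - δ) := by
  have h := complexSqrt_mul_self ((Λ - δ) ^ 2 - 4 * Λ)
  unfold muMinus
  push_cast at h ⊢
  linear_combination h / 4

/-- Subtraction leaves `(Λ - Λ')(μ - 1 - δ) = 0`, and `μ = 1 + δ` would force `(1 + δ) · 1 = 0`. -/
theorem eq_of_quadratic {δ Λ Λ' : ℝ} (hδ : 0 < δ) {μ : ℂ} (h : μ * (μ - δ) = Λ * (μ - 1 - δ))
    (h' : μ * (μ - δ) = Λ' * (μ - 1 - δ)) : Λ = Λ' := by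
  have h1 : ((Λ : ℂ) - Λ') * (μ - 1 - δ) = 0 := by linear_combination h' - h
  rcases mul_eq_zero.1 h1 with h2 | h2
  · exact_mod_cast sub_eq_zero.1 h2
  · rw [h2, mul_zero] at h
    have hμ : μ = ((1 + δ : ℝ) : ℂ) := by push_cast; linear_combination h2
    rw [hμ, ← Complex.ofReal_sub, ← Complex.ofReal_mul, Complex.ofReal_eq_zero] at h
    nlinarith

theorem muPlus_sub_muMinus (δ Λ : ℝ) :
    muPlus δ Λ - muMinus δ Λ = complexSqrt ((Λ - δ) ^ 2 - 4 * Λ) := by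
  unfold muPlus muMinus; ring

theorem muPlus_sub_muMinus_ne_zero {δ Λ : ℝ} (hΛ : 0 < Λ)
    (h : δ ≠ Λ + 2 * √Λ ∧ δ ≠ Λ - 2 * √Λ) : muPlus δ Λ - muMinus δ Λ ≠ 0 := by
  rw [muPlus_sub_muMinus]
  intro h0
  have h1 := complexSqrt_mul_self ((Λ - δ) ^ 2 - 4 * Λ)
  rw [h0, mul_zero] at h1
  have h2 : (Λ - δ) ^ 2 - 4 * Λ = 0 := by exact_mod_cast h1.symm
  have h3 : (Λ - δ - 2 * √Λ) * (Λ - δ + 2 * √Λ) = 0 := by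
    nlinarith [Real.mul_self_sqrt hΛ.le]
  rcases mul_eq_zero.1 h3 with h4 | h4
  · exact h.2 (by linarith)
  · exact h.1 (by linarith)

theorem muPlus_re (δ Λ : ℝ) : (muPlus δ Λ).re = (Λ + δ + √((Λ - δ) ^ 2 - 4 * Λ)) / 2 := by
  simp [muPlus, complexSqrt]

theorem muMinus_re (δ Λ : ℝ) : (muMinus δ Λ).re = (Λ + δ - √((Λ - δ) ^ 2 - 4 * Λ)) / 2 := by
  simp [muMinus, complexSqrt]

theorem muMinus_re_le_muPlus_re (δ Λ : ℝ) : (muMinus δ Λ).re ≤ (muPlus δ Λ).re := by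
  rw [muPlus_re, muMinus_re]
  linarith [Real.sqrt_nonneg ((Λ - δ) ^ 2 - 4 * Λ)]

theorem muMinus_re_pos {δ Λ : ℝ} (hδ : 0 < δ) (hΛ : 0 < Λ) : 0 < (muMinus δ Λ).re := by
  rw [muMinus_re]
  have : √((Λ - δ) ^ 2 - 4 * Λ) < Λ + δ := by
    rw [Real.sqrt_lt' (by positivity)]
    nlinarith [mul_pos hδ hΛ]
  linarith

/-- The bounds `max (Λ / 2) (Λ - 3δ - 4) ≤ √((Λ - δ)² - 4Λ) ≤ Λ - δ - 2` for large `Λ`. -/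
theorem sqrt_discrim_bounds {δ Λ : ℝ} (hδ : 0 < δ) (hΛ : 4 * δ + 8 ≤ Λ) :
    Λ / 2 ≤ √((Λ - δ) ^ 2 - 4 * Λ) ∧ Λ - 3 * δ - 4 ≤ √((Λ - δ) ^ 2 - 4 * Λ) ∧
      √((Λ - δ) ^ 2 - 4 * Λ) ≤ Λ - δ - 2 := by
  refine ⟨Real.le_sqrt_of_sq_le ?_, Real.le_sqrt_of_sq_le ?_, ?_⟩
  · nlinarith
  · nlinarith
  · rw [Real.sqrt_le_left (by linarith)]
    nlinarith

theorem one_add_le_muMinus_re {δ Λ : ℝ} (hδ : 0 < δ) (hΛ : 4 * δ + 8 ≤ Λ) :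
    1 + δ ≤ (muMinus δ Λ).re := by
  rw [muMinus_re]
  linarith [(sqrt_discrim_bounds hδ hΛ).2.2]

/-- The coefficient of `e^{-μ⁺ t}` in the free evolution of a mode. -/
def coefPlus (δ Λ : ℝ) : ℂ := (muPlus δ Λ - δ) / (muPlus δ Λ - muMinus δ Λ)

/-- The coefficient of `e^{-μ⁻ t}` in the free evolution of a mode. -/
def coefMinus (δ Λ : ℝ) : ℂ := (δ - muMinus δ Λ) / (muPlus δ Λ - muMinus δ Λ)

/-- These bounds compensate the factor `λ_n` in the components of `Ay`: the `μ^-` part has a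
coefficient of order `1/λ_n`, while the `μ^+` part gains `1 / Re μ^+` from the time integration. -/
theorem coef_bounds_of_large {δ Λ : ℝ} (hδ : 0 < δ) (hΛ : 4 * δ + 8 ≤ Λ) :
    ‖coefPlus δ Λ‖ ≤ 2 ∧ (1 + Λ) * ‖coefMinus δ Λ‖ ≤ 4 * (δ + 2) ∧
      Λ / (muPlus δ Λ).re ≤ 2 := by
  obtain ⟨h1, h2, h3⟩ := sqrt_discrim_bounds hδ hΛ
  have hd : 0 < √((Λ - δ) ^ 2 - 4 * Λ) := by linarith
  have hD : complexSqrt ((Λ - δ) ^ 2 - 4 * Λ) = (√((Λ - δ) ^ 2 - 4 * Λ) : ℝ) := by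
    have : -((Λ - δ) ^ 2 - 4 * Λ) ≤ 0 := by
      have := (Real.sqrt_pos.1 hd).le
      linarith
    rw [complexSqrt, Real.sqrt_eq_zero_of_nonpos this]
    simp
  have e1 := muPlus_re δ Λ
  set d := √((Λ - δ) ^ 2 - 4 * Λ)
  have hp : coefPlus δ Λ = (((Λ - δ + d) / 2 / d : ℝ) : ℂ) := by
    rw [coefPlus, muPlus_sub_muMinus, muPlus, hD]
    push_cast; ring
  have hm : coefMinus δ Λ = ((-((Λ - δ - d) / 2 / d) : ℝ) : ℂ) := by
    rw [coefMinus, muPlus_sub_muMinus, muMinus, hD]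
    push_cast; ring
  refine ⟨?_, ?_, ?_⟩
  · rw [hp, Complex.norm_real, Real.norm_of_nonneg (div_nonneg (by linarith) hd.le),
      div_le_iff₀ hd]
    linarith
  · rw [hm, Complex.norm_real, norm_neg, Real.norm_of_nonneg (div_nonneg (by linarith) hd.le),
      ← mul_div_assoc, div_le_iff₀ hd]
    nlinarith
  · rw [e1, div_le_iff₀ (by linarith)]
    linarith

theorem exists_forall_le_of_eventually {f : ℕ → ℝ} {c : ℝ} (h : ∀ᶠ n in Filter.atTop, f n ≤ c) :
    ∃ C, ∀ n, f n ≤ C := by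
  have : Filter.IsBoundedUnder (· ≤ ·) Filter.atTop f := ⟨c, Filter.eventually_map.2 h⟩
  obtain ⟨C, hC⟩ := this.bddAbove_range
  exact ⟨C, fun n => hC ⟨n, rfl⟩⟩

theorem exists_coef_bound {δ : ℝ} (hδ : 0 < δ) {lam : ℕ → ℝ}
    (hlam : Filter.Tendsto lam Filter.atTop Filter.atTop) :
    ∃ C, 0 < C ∧ ∀ n, ‖coefPlus δ (lam n)‖ ≤ C ∧ (1 + lam n) * ‖coefMinus δ (lam n)‖ ≤ C ∧
      lam n / (muPlus δ (lam n)).re ≤ C := by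
  have hlarge := hlam.eventually_ge_atTop (4 * δ + 8)
  obtain ⟨C₁, h₁⟩ := exists_forall_le_of_eventually
    (hlarge.mono fun n hn => (coef_bounds_of_large hδ hn).1)
  obtain ⟨C₂, h₂⟩ := exists_forall_le_of_eventually
    (hlarge.mono fun n hn => (coef_bounds_of_large hδ hn).2.1)
  obtain ⟨C₃, h₃⟩ := exists_forall_le_of_eventually
    (hlarge.mono fun n hn => (coef_bounds_of_large hδ hn).2.2)
  refine ⟨|C₁| + |C₂| + |C₃| + 1, by positivity, fun n => ⟨?_, ?_, ?_⟩⟩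
  · linarith [h₁ n, le_abs_self C₁, abs_nonneg C₂, abs_nonneg C₃]
  · linarith [h₂ n, le_abs_self C₂, abs_nonneg C₁, abs_nonneg C₃]
  · linarith [h₃ n, le_abs_self C₃, abs_nonneg C₁, abs_nonneg C₂]

theorem lt_muMinus_re_of_unstableDim_le {δ γ : ℝ} (hδ : 0 < δ) (hγ : γ < δ + 1) {lam : ℕ → ℝ}
    (hlam : Filter.Tendsto lam Filter.atTop Filter.atTop) {n : ℕ} (hn : unstableDim δ γ lam ≤ n) :
    γ < (muMinus δ (lam n)).re := by
  by_contra! h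
  -- Without boundedness the supremum in `ℕ` would be the default value `0`.
  have hbdd : BddAbove {n : ℕ | ∃ j : ℕ, n = j + 1 ∧ (muMinus δ (lam j)).re ≤ γ} := by
    obtain ⟨m, hm⟩ := Filter.eventually_atTop.1 (hlam.eventually_ge_atTop (4 * δ + 8))
    refine ⟨m, ?_⟩
    rintro _ ⟨j, rfl, hj⟩
    by_contra! hlt
    linarith [one_add_le_muMinus_re hδ (hm j (by omega))]
  -- The zero-based index `n` occurs in the set as `n + 1`, so `n + 1 ≤ N ≤ n`.
  have := le_csSup hbdd ⟨n, rfl, h⟩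
  have h2 := (le_max_right _ _).trans hn
  omega

/-- Positivity excludes the two cases, empty and unbounded, in which the supremum in `ℕ` is `0` by
default. -/
theorem sSup_mem_of_pos {S : Set ℕ} (h : 0 < sSup S) : sSup S ∈ S := by
  refine Nat.sSup_mem (Set.nonempty_iff_ne_empty.2 fun h0 => ?_) ?_
  · rw [h0, csSup_empty, bot_eq_zero] at h
    exact h.false
  · by_contra hb
    rw [Nat.sSup_of_not_bddAbove hb] at h
    exact h.false

/-- Both suprema in the definition of `unstableDim` are attained on whole eigenspaces. -/
theorem lt_unstableDim_of_eq {δ γ : ℝ} (hδ : 0 < δ) (hγ : γ < δ + 1) {lam : ℕ → ℝ}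
    (hlam : Filter.Tendsto lam Filter.atTop Filter.atTop) (hmono : Monotone lam) {j n : ℕ}
    (hj : j < unstableDim δ γ lam) (h : lam n = lam j) : n < unstableDim δ γ lam := by
  by_contra! hn
  have hpos : 0 < unstableDim δ γ lam := by omega
  -- By monotonicity `lam` is constant from `j` to `n`, so index `N - 1` carries the same
  -- eigenvalue; its slow root contradicts the strict bound at `n ≥ N`.
  have hlast : lam n = lam (unstableDim δ γ lam - 1) :=
    le_antisymm (h ▸ hmono (by omega)) (hmono (by omega))
  have hlt := lt_muMinus_re_of_unstableDim_le hδ hγ hlam hn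
  rcases max_choice (sSup {n : ℕ | ∃ j : ℕ, n = j + 1 ∧ (muPlus δ (lam j)).re ≤ γ})
    (sSup {n : ℕ | ∃ j : ℕ, n = j + 1 ∧ (muMinus δ (lam j)).re ≤ γ}) with hm | hm
  all_goals
    change unstableDim δ γ lam = _ at hm
    have hmem := sSup_mem_of_pos (hm ▸ hpos)
    rw [← hm] at hmem
    obtain ⟨i, hi, hi'⟩ := hmem
    rw [hlast, hi, Nat.add_sub_cancel] at hlt
    linarith [muMinus_re_le_muPlus_re δ (lam i)]

end Exponents

/-! ### Explicit solution of a single mode. -/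

section Modes

/-- The solution of `E' = -μ E + f`, `E 0 = a`. -/
def duhamel (μ a : ℂ) (f : ℝ → ℂ) (t : ℝ) : ℂ :=
  Complex.exp (-μ * t) * (a + ∫ s in (0 : ℝ)..t, Complex.exp (μ * s) * f s)

theorem duhamel_zero (μ a : ℂ) (f : ℝ → ℂ) : duhamel μ a f 0 = a := by simp [duhamel]

theorem hasDerivAt_duhamel (μ a : ℂ) {f : ℝ → ℂ} (hf : Continuous f) (t : ℝ) :
    HasDerivAt (duhamel μ a f) (-μ * duhamel μ a f t + f t) t := by
  have hc : Continuous fun s : ℝ => Complex.exp (μ * s) * f s := by fun_prop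
  have h := (hasDerivAt_cexp_mul (-μ) t).mul ((hc.integral_hasStrictDerivAt 0 t).hasDerivAt.const_add a)
  refine h.congr_deriv ?_
  have he : Complex.exp (-μ * t) * Complex.exp (μ * t) = 1 := by
    rw [← Complex.exp_add]; simp
  unfold duhamel
  linear_combination f t * he

theorem norm_cexp_mul_ofReal (μ : ℂ) (t : ℝ) : ‖Complex.exp (μ * t)‖ = Real.exp (μ.re * t) := by
  simp [Complex.norm_exp]

/-- The factor `1 / Re μ` multiplying the force is the parabolic gain used for `μ^+`; no support
condition enters. -/
theorem norm_duhamel_le {μ a : ℂ} {f : ℝ → ℂ} {F t : ℝ} (hμ : 0 < μ.re)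
    (hF : ∀ s, ‖f s‖ ≤ F) (ht : 0 ≤ t) : ‖duhamel μ a f t‖ ≤ ‖a‖ + F / μ.re := by
  have hF0 : 0 ≤ F := (norm_nonneg _).trans (hF 0)
  have he : Real.exp (-μ.re * t) ≤ 1 := Real.exp_le_one_iff.2 (by nlinarith)
  have hint : ‖∫ s in (0 : ℝ)..t, Complex.exp (μ * s) * f s‖
      ≤ ∫ s in (0 : ℝ)..t, Real.exp (μ.re * s) * F := by
    refine intervalIntegral.norm_integral_le_of_norm_le ht (Filter.Eventually.of_forall fun s _ => ?_)
      (Continuous.intervalIntegrable (by fun_prop) _ _)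
    rw [norm_mul, norm_cexp_mul_ofReal]
    exact mul_le_mul_of_nonneg_left (hF s) (Real.exp_pos _).le
  have hval : ∫ s in (0 : ℝ)..t, Real.exp (μ.re * s) * F
      = Real.exp (μ.re * t) / μ.re * F - 1 / μ.re * F := by
    rw [intervalIntegral.integral_eq_sub_of_hasDerivAt
      (f := fun s => Real.exp (μ.re * s) / μ.re * F) (fun s _ => ?_)
      (Continuous.intervalIntegrable (by fun_prop) _ _)]
    · simp
    · have h1 : HasDerivAt (fun s => μ.re * s) μ.re s := by
        simpa using (hasDerivAt_id s).const_mul μ.re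
      refine ((h1.exp.div_const μ.re).mul_const F).congr_deriv ?_
      field_simp
  rw [hval] at hint
  have hexp : Real.exp (-μ.re * t) * Real.exp (μ.re * t) = 1 := by
    rw [← Real.exp_add]; simp
  calc ‖duhamel μ a f t‖
      ≤ Real.exp (-μ.re * t) * (‖a‖ + (Real.exp (μ.re * t) / μ.re * F - 1 / μ.re * F)) := by
        rw [duhamel, norm_mul, norm_cexp_mul_ofReal, Complex.neg_re]
        exact mul_le_mul_of_nonneg_left ((norm_add_le _ _).trans (by linarith)) (Real.exp_pos _).le
    _ = Real.exp (-μ.re * t) * ‖a‖ + (1 - Real.exp (-μ.re * t)) * (F / μ.re) := by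
        linear_combination (F / μ.re) * hexp
    _ ≤ 1 * ‖a‖ + 1 * (F / μ.re) := by
        gcongr
        linarith [Real.exp_pos (-μ.re * t)]
    _ = _ := by ring

/-- Once the force has stopped the bracket is frozen, so the term vanishes from `T` on exactly when
the moment condition holds. -/
theorem duhamel_of_le {μ a : ℂ} {f : ℝ → ℂ} {T t : ℝ} (hf : Continuous f)
    (hs : ∀ s, T ≤ s → f s = 0) (h : T ≤ t) :
    duhamel μ a f t
      = Complex.exp (-μ * t) * (a + ∫ s in (0 : ℝ)..T, Complex.exp (μ * s) * f s) := by
  have hc : Continuous fun s : ℝ => Complex.exp (μ * s) * f s := by fun_prop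
  have h0 : ∫ s in T..t, Complex.exp (μ * s) * f s = 0 := by
    rw [intervalIntegral.integral_congr (g := fun _ => (0 : ℂ)), intervalIntegral.integral_zero]
    intro s hs'
    rw [Set.uIcc_of_le h] at hs'
    simp [hs s hs'.1]
  rw [duhamel, ← intervalIntegral.integral_add_adjacent_intervals (hc.intervalIntegrable 0 T)
    (hc.intervalIntegrable T t), h0, add_zero]

/-- The force acts only at times `s ≤ T`, where `e^{-ρ(t-s)} ≤ e^{ρT} e^{-ρt}`. Nothing is divided
by `Re μ`, so `ρ = 0` and `ρ = Re μ` are allowed. -/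
theorem norm_duhamel_le_exp {μ a : ℂ} {f : ℝ → ℂ} {F T ρ t : ℝ} (hT : 0 < T) (hρ : 0 ≤ ρ)
    (hμ : ρ ≤ μ.re) (hf : Continuous f) (hF : ∀ s, ‖f s‖ ≤ F) (hs : ∀ s, T ≤ s → f s = 0)
    (ht : 0 ≤ t) :
    ‖duhamel μ a f t‖ ≤ Real.exp (-ρ * t) * (Real.exp (ρ * T) * (‖a‖ + T * F)) := by
  have hF0 : 0 ≤ F := (norm_nonneg _).trans (hF 0)
  -- `τ = min t T`.
  obtain ⟨τ, hτ0, hτt, hτT, hE⟩ : ∃ τ, 0 ≤ τ ∧ τ ≤ t ∧ τ ≤ T ∧ duhamel μ a f t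
      = Complex.exp (-μ * t) * (a + ∫ s in (0 : ℝ)..τ, Complex.exp (μ * s) * f s) := by
    rcases le_total t T with h | h
    · exact ⟨t, ht, le_rfl, h, rfl⟩
    · exact ⟨T, hT.le, h, le_rfl, duhamel_of_le hf hs h⟩
  have hint : ‖∫ s in (0 : ℝ)..τ, Complex.exp (-μ * t) * (Complex.exp (μ * s) * f s)‖
      ≤ Real.exp (-ρ * t) * Real.exp (ρ * T) * F * |τ - 0| := by
    refine intervalIntegral.norm_integral_le_of_norm_le_const fun s hs' => ?_
    rw [Set.uIoc_of_le hτ0] at hs'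
    rw [norm_mul, norm_mul, norm_cexp_mul_ofReal, norm_cexp_mul_ofReal, ← mul_assoc,
      ← Real.exp_add, ← Real.exp_add, Complex.neg_re]
    refine mul_le_mul (Real.exp_le_exp.2 ?_) (hF s) (norm_nonneg _) (Real.exp_pos _).le
    nlinarith [hs'.1, hs'.2]
  rw [intervalIntegral.integral_const_mul, sub_zero, abs_of_nonneg hτ0] at hint
  have ha : ‖Complex.exp (-μ * t) * a‖ ≤ Real.exp (-ρ * t) * ‖a‖ := by
    rw [norm_mul, norm_cexp_mul_ofReal, Complex.neg_re]
    refine mul_le_mul_of_nonneg_right (Real.exp_le_exp.2 ?_) (norm_nonneg _)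
    nlinarith
  have h1 : 1 ≤ Real.exp (ρ * T) := Real.one_le_exp (by positivity)
  rw [hE, mul_add]
  calc _ ≤ Real.exp (-ρ * t) * ‖a‖ + Real.exp (-ρ * t) * Real.exp (ρ * T) * F * τ :=
        (norm_add_le _ _).trans (add_le_add ha hint)
    _ ≤ Real.exp (-ρ * t) * (Real.exp (ρ * T) * ‖a‖)
        + Real.exp (-ρ * t) * Real.exp (ρ * T) * F * T := by
        gcongr
        exact le_mul_of_one_le_left (norm_nonneg _) h1
    _ = _ := by ring

/-- The component of the solution along an eigenvector with eigenvalue `Λ`. -/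
def mode (δ Λ : ℝ) (a : ℂ) (f : ℝ → ℂ) (t : ℝ) : ℂ :=
  coefPlus δ Λ * duhamel (muPlus δ Λ) a f t + coefMinus δ Λ * duhamel (muMinus δ Λ) a f t

/-- The memory term `∫₀ᵗ e^{-δ(t-s)} y(s) ds` of `mode`. -/
def modeMemory (δ Λ : ℝ) (a : ℂ) (f : ℝ → ℂ) (t : ℝ) : ℂ :=
  (duhamel (muMinus δ Λ) a f t - duhamel (muPlus δ Λ) a f t) / (muPlus δ Λ - muMinus δ Λ)

variable {δ Λ : ℝ} {a : ℂ} {f : ℝ → ℂ}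

theorem coefPlus_add_coefMinus (h : muPlus δ Λ - muMinus δ Λ ≠ 0) :
    coefPlus δ Λ + coefMinus δ Λ = 1 := by
  rw [coefPlus, coefMinus, ← add_div, div_eq_one_iff_eq h]; ring

theorem mode_zero (h : muPlus δ Λ - muMinus δ Λ ≠ 0) : mode δ Λ a f 0 = a := by
  rw [mode, duhamel_zero, duhamel_zero, ← add_mul, coefPlus_add_coefMinus h, one_mul]

theorem modeMemory_zero : modeMemory δ Λ a f 0 = 0 := by
  simp [modeMemory, duhamel_zero]

/-- Comparing the coefficients of the two Duhamel terms leaves `-μ(μ - δ) = -Λ(μ - 1 - δ)` for each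
root. -/
theorem hasDerivAt_mode (h : muPlus δ Λ - muMinus δ Λ ≠ 0) (hf : Continuous f) (t : ℝ) :
    HasDerivAt (mode δ Λ a f) (f t - Λ * mode δ Λ a f t - Λ * modeMemory δ Λ a f t) t := by
  have hd := ((hasDerivAt_duhamel (muPlus δ Λ) a hf t).const_mul (coefPlus δ Λ)).add
    ((hasDerivAt_duhamel (muMinus δ Λ) a hf t).const_mul (coefMinus δ Λ))
  refine hd.congr_deriv ?_
  have h1 := coefPlus_add_coefMinus h
  have hp := muPlus_quadratic δ Λ
  have hm := muMinus_quadratic δ Λ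
  rw [mode, modeMemory]
  have e : (coefPlus δ Λ * (-muPlus δ Λ * duhamel (muPlus δ Λ) a f t + f t) +
      coefMinus δ Λ * (-muMinus δ Λ * duhamel (muMinus δ Λ) a f t + f t))
      = f t * (coefPlus δ Λ + coefMinus δ Λ) - (coefPlus δ Λ * muPlus δ Λ * duhamel (muPlus δ Λ) a f t
        + coefMinus δ Λ * muMinus δ Λ * duhamel (muMinus δ Λ) a f t) := by ring
  rw [e, h1]
  unfold coefPlus coefMinus
  field_simp
  linear_combination -(duhamel (muPlus δ Λ) a f t) * hp + (duhamel (muMinus δ Λ) a f t) * hm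

theorem hasDerivAt_modeMemory (h : muPlus δ Λ - muMinus δ Λ ≠ 0) (hf : Continuous f) (t : ℝ) :
    HasDerivAt (modeMemory δ Λ a f) (mode δ Λ a f t - δ * modeMemory δ Λ a f t) t := by
  have hd := ((hasDerivAt_duhamel (muMinus δ Λ) a hf t).sub
    (hasDerivAt_duhamel (muPlus δ Λ) a hf t)).div_const (muPlus δ Λ - muMinus δ Λ)
  refine hd.congr_deriv ?_
  unfold mode modeMemory coefPlus coefMinus
  field_simp
  ring

theorem continuous_mode (h : muPlus δ Λ - muMinus δ Λ ≠ 0) (hf : Continuous f) :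
    Continuous (mode δ Λ a f) :=
  continuous_iff_continuousAt.2 fun t => (hasDerivAt_mode h hf t).continuousAt

end Modes

/-! ### Vector-valued functions built from coefficients in a Hilbert basis. -/

section HilbertBasis

variable {E : Type*} [NormedAddCommGroup E] [InnerProductSpace ℂ E] [CompleteSpace E]
  (b : HilbertBasis ℕ ℂ E)

theorem hasSum_sq_norm_inner (x : E) : HasSum (fun n => ‖⟪b n, x⟫_ℂ‖ ^ 2) (‖x‖ ^ 2) := by
  have h := b.hasSum_inner_mul_inner x x
  rw [inner_self_eq_norm_sq_to_K] at h
  have h2 := Complex.hasSum_re h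
  convert h2 using 1
  · ext n
    rw [← inner_conj_symm, Complex.mul_conj, Complex.ofReal_re, Complex.normSq_eq_norm_sq,
      RCLike.norm_conj]
  · norm_cast

theorem norm_sq_le_tsum {x : E} {d : ℕ → ℝ} (hd : Summable fun n => d n ^ 2)
    (h : ∀ n, ‖⟪b n, x⟫_ℂ‖ ≤ d n) : ‖x‖ ^ 2 ≤ ∑' n, d n ^ 2 := by
  rw [← (hasSum_sq_norm_inner b x).tsum_eq]
  exact (hasSum_sq_norm_inner b x).summable.tsum_le_tsum
    (fun n => pow_le_pow_left₀ (norm_nonneg _) (h n) 2) hd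

theorem eq_of_forall_inner_eq {x y : E} (h : ∀ n, ⟪b n, x⟫_ℂ = ⟪b n, y⟫_ℂ) : x = y := by
  rw [← sub_eq_zero, ← norm_eq_zero, ← sq_eq_zero_iff]
  refine le_antisymm ?_ (sq_nonneg _)
  have := norm_sq_le_tsum b (x := x - y) (d := fun _ => 0) (by simp [summable_zero]) fun n => by
    rw [inner_sub_right, h, sub_self, norm_zero]
  simpa using this

theorem exists_inner_eq {c : ℕ → ℂ} (hc : Summable fun n => ‖c n‖ ^ 2) :
    ∃ x : E, ∀ n, ⟪b n, x⟫_ℂ = c n := by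
  have hmem : Memℓp c 2 := by
    rw [memℓp_gen_iff (by norm_num)]
    simpa using hc
  refine ⟨b.repr.symm ⟨c, hmem⟩, fun n => ?_⟩
  rw [← b.repr_apply_apply, LinearIsometryEquiv.apply_symm_apply]

/-- A Weierstrass test in `ℓ²`: the majorant `c` makes the partial sums converge uniformly on `s`,
so continuity passes to the limit. -/
theorem exists_continuousOn_inner_eq {s : Set ℝ} {Y : ℕ → ℝ → ℂ} {c : ℕ → ℝ}
    (hc : Summable fun n => c n ^ 2) (hY : ∀ n, ContinuousOn (Y n) s)
    (hle : ∀ n, ∀ t ∈ s, ‖Y n t‖ ≤ c n) :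
    ∃ y : ℝ → E, ContinuousOn y s ∧ ∀ t ∈ s, ∀ n, ⟪b n, y t⟫_ℂ = Y n t := by
  have hex : ∀ t : ℝ, ∃ x : E, t ∈ s → ∀ n, ⟪b n, x⟫_ℂ = Y n t := fun t => by
    by_cases ht : t ∈ s
    · obtain ⟨x, hx⟩ := exists_inner_eq b (c := fun n => Y n t) (hc.of_nonneg_of_le
        (fun n => by positivity) fun n => pow_le_pow_left₀ (norm_nonneg _) (hle n t ht) 2)
      exact ⟨x, fun _ => hx⟩
    · exact ⟨0, fun h => absurd h ht⟩
  choose y hy using hex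
  refine ⟨y, ?_, hy⟩
  have hunif : TendstoUniformlyOn (fun (m : ℕ) t => ∑ n ∈ Finset.range m, Y n t • b n) y
      Filter.atTop s := by
    rw [Metric.tendstoUniformlyOn_iff]
    intro ε hε
    have htail := tendsto_sum_nat_add fun n => c n ^ 2
    filter_upwards [htail.eventually (gt_mem_nhds (show 0 < ε ^ 2 by positivity))] with m hm t ht
    have hcoef (n : ℕ) : ⟪b n, y t - ∑ k ∈ Finset.range m, Y k t • b k⟫_ℂ
        = if n < m then 0 else Y n t := by
      rw [inner_sub_right, hy t ht, inner_sum]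
      simp only [inner_smul_right, orthonormal_iff_ite.1 b.orthonormal, mul_ite, mul_one, mul_zero,
        Finset.sum_ite_eq, Finset.mem_range]
      split_ifs <;> simp
    have hd : Summable fun n => (if n < m then 0 else c n) ^ 2 :=
      hc.of_nonneg_of_le (fun n => sq_nonneg _) fun n => by split_ifs <;> simp [sq_nonneg]
    have hle' := norm_sq_le_tsum b (x := y t - ∑ k ∈ Finset.range m, Y k t • b k) hd fun n => by
      rw [hcoef]
      split_ifs
      · simp
      · exact hle n t ht
    have htsum : ∑' n, (if n < m then 0 else c n) ^ 2 = ∑' k, c (k + m) ^ 2 := by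
      rw [← hd.sum_add_tsum_nat_add m, Finset.sum_eq_zero, zero_add]
      · refine tsum_congr fun k => ?_
        rw [if_neg (by omega)]
      · intro k hk
        rw [if_pos (Finset.mem_range.1 hk)]; simp
    rw [dist_eq_norm]
    exact lt_of_pow_lt_pow_left₀ 2 hε.le (hle'.trans_lt (htsum ▸ hm))
  exact hunif.continuousOn (Filter.Frequently.of_forall fun m =>
    continuousOn_finsetSum _ fun n _ => (hY n).smul continuousOn_const)

theorem inner_intervalIntegral (x : E) {g : ℝ → E} (hg : Continuous g) (s t : ℝ) :
    ⟪x, ∫ r in s..t, g r⟫_ℂ = ∫ r in s..t, ⟪x, g r⟫_ℂ :=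
  ((innerSL ℂ x).intervalIntegral_comp_comm (hg.intervalIntegrable s t)).symm

end HilbertBasis

/-! ### The memory term as the solution of a linear differential equation. -/

section Memory

variable {E : Type*} [NormedAddCommGroup E] [NormedSpace ℝ E] [CompleteSpace E]

theorem continuous_comp_max {g : ℝ → E} (hg : ContinuousOn g (Set.Ici 0)) :
    Continuous fun s => g (max s 0) :=
  hg.comp_continuous (by fun_prop) fun s => le_max_right s 0

/-- The memory term `∫₀ᵗ e^{-δ(t-s)} g(s) ds`, extended continuously to negative times. -/
def memory (δ : ℝ) (g : ℝ → E) (t : ℝ) : E :=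
  Real.exp (-δ * t) • ∫ s in (0 : ℝ)..t, Real.exp (δ * s) • g (max s 0)

theorem integral_smul_eq_memory {δ : ℝ} {β : ℝ → ℝ} (hβ : ∀ t, β t = Real.exp (-δ * t))
    (g : ℝ → E) {t : ℝ} (ht : 0 ≤ t) : ∫ s in (0 : ℝ)..t, β (t - s) • g s = memory δ g t := by
  rw [memory, ← intervalIntegral.integral_smul]
  refine intervalIntegral.integral_congr fun s hs => ?_
  rw [Set.uIcc_of_le ht] at hs
  simp only [hβ, max_eq_left hs.1, smul_smul, ← Real.exp_add]
  ring_nf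

theorem memory_zero (δ : ℝ) (g : ℝ → E) : memory δ g 0 = 0 := by simp [memory]

theorem hasDerivAt_memory (δ : ℝ) {g : ℝ → E} (hg : ContinuousOn g (Set.Ici 0)) (t : ℝ) :
    HasDerivAt (memory δ g) (g (max t 0) - δ • memory δ g t) t := by
  have hc : Continuous fun s => Real.exp (δ * s) • g (max s 0) :=
    (by fun_prop : Continuous fun s => Real.exp (δ * s)).smul (continuous_comp_max hg)
  have h1 : HasDerivAt (fun s => Real.exp (-δ * s)) (Real.exp (-δ * t) * (-δ)) t := by
    have : HasDerivAt (fun s => -δ * s) (-δ) t := by simpa using (hasDerivAt_id t).const_mul (-δ)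
    exact this.exp
  have h := h1.smul (hc.integral_hasStrictDerivAt 0 t).hasDerivAt
  refine h.congr_deriv ?_
  have he : Real.exp (-δ * t) * Real.exp (δ * t) = 1 := by rw [← Real.exp_add]; simp
  rw [memory, smul_smul, he, one_smul]
  module

theorem continuous_memory (δ : ℝ) {g : ℝ → E} (hg : ContinuousOn g (Set.Ici 0)) :
    Continuous (memory δ g) :=
  continuous_iff_continuousAt.2 fun t => (hasDerivAt_memory δ hg t).continuousAt

theorem memory_congr (δ : ℝ) {g h : ℝ → E} (hgh : Set.EqOn g h (Set.Ici 0)) (t : ℝ) :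
    memory δ g t = memory δ h t := by
  unfold memory
  congr 2 with s
  rw [hgh (le_max_right s 0)]

theorem memory_sub (δ : ℝ) {g h : ℝ → E} (hg : ContinuousOn g (Set.Ici 0))
    (hh : ContinuousOn h (Set.Ici 0)) (t : ℝ) :
    memory δ (fun s => g s - h s) t = memory δ g t - memory δ h t := by
  have h1 {z : ℝ → E} (hz : ContinuousOn z (Set.Ici 0)) :
      IntervalIntegrable (fun s => Real.exp (δ * s) • z (max s 0)) MeasureTheory.volume 0 t :=
    ((by fun_prop : Continuous fun s => Real.exp (δ * s)).smul
      (continuous_comp_max hz)).intervalIntegrable _ _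
  unfold memory
  rw [← smul_sub, ← intervalIntegral.integral_sub (h1 hg) (h1 hh)]
  simp_rw [smul_sub]

/-- The memory term is the only solution of `w' = g - δ w`, `w 0 = 0`. -/
theorem eq_memory_of_hasDerivAt {δ : ℝ} {g w : ℝ → E} (hg : ContinuousOn g (Set.Ici 0))
    (hw0 : w 0 = 0) (hw : ∀ t, 0 ≤ t → HasDerivAt w (g t - δ • w t) t) {t : ℝ} (ht : 0 ≤ t) :
    w t = memory δ g t := by
  have hderiv : ∀ s ∈ Set.uIcc 0 t,
      HasDerivAt (fun s => Real.exp (δ * s) • w s) (Real.exp (δ * s) • g (max s 0)) s := by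
    intro s hs
    rw [Set.uIcc_of_le ht] at hs
    have h1 : HasDerivAt (fun s => Real.exp (δ * s)) (Real.exp (δ * s) * δ) s := by
      have : HasDerivAt (fun s => δ * s) δ s := by simpa using (hasDerivAt_id s).const_mul δ
      exact this.exp
    refine (h1.smul (hw s hs.1)).congr_deriv ?_
    rw [max_eq_left hs.1]
    module
  have hc : Continuous fun s => Real.exp (δ * s) • g (max s 0) :=
    (by fun_prop : Continuous fun s => Real.exp (δ * s)).smul (continuous_comp_max hg)
  rw [memory, intervalIntegral.integral_eq_sub_of_hasDerivAt hderiv (hc.intervalIntegrable _ _),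
    hw0, smul_zero, sub_zero, smul_smul, ← Real.exp_add]
  simp

theorem inner_memory {E : Type*} [NormedAddCommGroup E] [InnerProductSpace ℂ E] [CompleteSpace E]
    (δ : ℝ) (x : E) {g : ℝ → E} (hg : ContinuousOn g (Set.Ici 0)) (t : ℝ) :
    ⟪x, memory δ g t⟫_ℂ = memory δ (fun s => ⟪x, g s⟫_ℂ) t := by
  have hc : Continuous fun s => Real.exp (δ * s) • g (max s 0) :=
    (by fun_prop : Continuous fun s => Real.exp (δ * s)).smul (continuous_comp_max hg)
  rw [memory, memory, inner_smul_right_eq_smul, inner_intervalIntegral x hc]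
  simp_rw [inner_smul_right_eq_smul]

theorem eq_exp_of_hasDerivAt {δ : ℝ} {β : ℝ → ℝ} (hβ : ∀ t, HasDerivAt β (-δ * β t) t)
    (hβ0 : β 0 = 1) (t : ℝ) : β t = Real.exp (-δ * t) := by
  have hd : ∀ s, HasDerivAt (fun s => Real.exp (δ * s) * β s) 0 s := fun s => by
    have h1 : HasDerivAt (fun s => Real.exp (δ * s)) (Real.exp (δ * s) * δ) s := by
      have : HasDerivAt (fun s => δ * s) δ s := by simpa using (hasDerivAt_id s).const_mul δ
      exact this.exp
    exact (h1.mul (hβ s)).congr_deriv (by ring)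
  have hconst := is_const_of_deriv_eq_zero (fun s => (hd s).differentiableAt)
    (fun s => (hd s).deriv) t 0
  simp only [hβ0, mul_zero, Real.exp_zero, one_mul] at hconst
  rw [neg_mul, Real.exp_neg, eq_comm, inv_eq_of_mul_eq_one_right hconst]

/-- Uniqueness for the scalar equation `d' = -Λ (d + ∫₀ᵗ e^{-δ(t-s)} d(s) ds)`, `d 0 = 0`. -/
theorem eq_zero_of_hasDerivWithinAt_memory {δ Λ : ℝ} {d : ℝ → ℂ} (h0 : d 0 = 0)
    (hd : ∀ t, 0 ≤ t → HasDerivWithinAt d (-Λ * d t - Λ * memory δ d t) (Set.Ici 0) t) {t : ℝ}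
    (ht : 0 ≤ t) : d t = 0 := by
  have hc : ContinuousOn d (Set.Ici 0) := fun s hs => (hd s hs).continuousWithinAt
  -- Adjoining the memory as a second unknown gives a planar autonomous linear system with generator
  -- `L`, to which uniqueness for Lipschitz equations applies.
  let L : ℂ × ℂ →L[ℂ] ℂ × ℂ :=
    ((-Λ : ℂ) • ContinuousLinearMap.fst ℂ ℂ ℂ - (Λ : ℂ) • ContinuousLinearMap.snd ℂ ℂ ℂ).prod
      (ContinuousLinearMap.fst ℂ ℂ ℂ - (δ : ℂ) • ContinuousLinearMap.snd ℂ ℂ ℂ)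
  have huniq := ODE_solution_unique (v := fun _ => L) (K := ‖L‖₊)
    (f := fun s => (d s, memory δ d s)) (g := fun _ => 0) (a := 0) (b := t)
    (fun _ => L.lipschitz) ((hc.mono Set.Icc_subset_Ici_self).prodMk
      (continuous_memory δ hc).continuousOn) (fun s hs => ?_) continuousOn_const (fun s _ => ?_) ?_
  · exact congrArg Prod.fst (huniq (Set.right_mem_Icc.2 ht))
  · refine (((hd s hs.1).mono (Set.Ici_subset_Ici.2 hs.1)).prodMk
      (hasDerivAt_memory δ hc s).hasDerivWithinAt).congr_deriv ?_
    simp [L, max_eq_left hs.1]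
  · simpa using hasDerivWithinAt_const s (Set.Ici s) (0 : ℂ × ℂ)
  · simp [h0, memory_zero]

end Memory

/-! ### From modal solutions to weak and classical solutions. -/

section Solutions

variable {H : Type*} [NormedAddCommGroup H] [InnerProductSpace ℝ H] [CompleteSpace H]
  {A : H →ₗ.[ℝ] H} {B : H →L[ℝ] H} {lam : ℕ → ℝ} {φ : ℕ → H} {δ : ℝ} {β : ℝ → ℝ}
  {u : ℝ → Complexification H} {y₀ : Complexification H} {y : ℝ → Complexification H}

theorem integral_mul_inner_eq_memory (hβ : ∀ t, β t = Real.exp (-δ * t)) (x : Complexification H)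
    {t : ℝ} (ht : 0 ≤ t) : ∫ s in (0 : ℝ)..t, (β (t - s) : ℂ) * ⟪x, y s⟫_ℂ
      = memory δ (fun s => ⟪x, y s⟫_ℂ) t := by
  rw [← integral_smul_eq_memory hβ _ ht]
  simp [Complex.real_smul]

theorem IsWeakSolution.hasDerivWithinAt_inner (hφ : IsEigenSystem A lam φ)
    (hβ : ∀ t, β t = Real.exp (-δ * t)) (hy : IsWeakSolution A B β u y₀ y) (n : ℕ) {t : ℝ}
    (ht : 0 ≤ t) : HasDerivWithinAt (fun s => ⟪ofReal (φ n), y s⟫_ℂ)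
      (⟪ofReal (φ n), mapCLM B (u t)⟫_ℂ - lam n * ⟪ofReal (φ n), y t⟫_ℂ
        - lam n * memory δ (fun s => ⟪ofReal (φ n), y s⟫_ℂ) t) (Set.Ici 0) t := by
  obtain ⟨h, h'⟩ := hφ.ofReal_mem_domain n
  have := hy.eqn ⟨ofReal (φ n), h⟩ t ht
  have e (z : Complexification H) :
      ⟪mapPMap A ⟨ofReal (φ n), h⟩, z⟫_ℂ = lam n * ⟪ofReal (φ n), z⟫_ℂ := by
    rw [h', inner_smul_left, Complex.conj_ofReal]
  simp_rw [e, mul_left_comm _ (lam n : ℂ)] at this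
  rwa [intervalIntegral.integral_const_mul, integral_mul_inner_eq_memory hβ _ ht] at this

/-- Testing with `φ_n` reduces uniqueness to the homogeneous scalar equation satisfied by the
difference of the components. -/
theorem IsWeakSolution.eqOn (hφ : IsEigenSystem A lam φ) (hA : IsSelfAdjoint A)
    (hcpt : HasCompactResolvent A) (hβ : ∀ t, β t = Real.exp (-δ * t))
    {y' : ℝ → Complexification H} (hy : IsWeakSolution A B β u y₀ y)
    (hy' : IsWeakSolution A B β u y₀ y') : Set.EqOn y' y (Set.Ici 0) := by
  intro t ht
  refine eq_of_forall_inner_eq (hφ.basisC hA hcpt) fun n => ?_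
  rw [hφ.coe_basisC, ← sub_eq_zero]
  have hc {z : ℝ → Complexification H} (hz : ContinuousOn z (Set.Ici 0)) :
      ContinuousOn (fun s => ⟪ofReal (φ n), z s⟫_ℂ) (Set.Ici 0) := continuousOn_const.inner hz
  refine eq_zero_of_hasDerivWithinAt_memory (δ := δ) (Λ := lam n)
    (d := fun s => ⟪ofReal (φ n), y' s⟫_ℂ - ⟪ofReal (φ n), y s⟫_ℂ) ?_ (fun s hs => ?_) ht
  · simp [hy.init, hy'.init]
  · refine ((hy'.hasDerivWithinAt_inner hφ hβ n hs).sub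
      (hy.hasDerivWithinAt_inner hφ hβ n hs)).congr_deriv ?_
    rw [memory_sub δ (hc hy'.cont) (hc hy.cont)]; ring

/-- `y` is the trajectory with initial value `y₀` and right-hand side `f`, described by its
components along the eigenvectors of `A`. -/
structure IsModalSolution (lam : ℕ → ℝ) (φ : ℕ → H) (δ : ℝ) (f : ℝ → Complexification H)
    (y₀ : Complexification H) (y : ℝ → Complexification H) : Prop where
  cont : ContinuousOn y (Set.Ici 0)
  inner_eq : ∀ t, 0 ≤ t → ∀ n, ⟪ofReal (φ n), y t⟫_ℂ
    = mode δ (lam n) ⟪ofReal (φ n), y₀⟫_ℂ (fun s => ⟪ofReal (φ n), f s⟫_ℂ) t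

variable {f : ℝ → Complexification H}

theorem continuous_inner_left (x : Complexification H) (hf : Continuous f) :
    Continuous fun s => ⟪x, f s⟫_ℂ := continuous_const.inner hf

theorem IsModalSolution.inner_memory_eq (hne : ∀ n, muPlus δ (lam n) - muMinus δ (lam n) ≠ 0)
    (hf : Continuous f) (hy : IsModalSolution lam φ δ f y₀ y) (n : ℕ) {t : ℝ} (ht : 0 ≤ t) :
    modeMemory δ (lam n) ⟪ofReal (φ n), y₀⟫_ℂ (fun s => ⟪ofReal (φ n), f s⟫_ℂ) t
      = ⟪ofReal (φ n), memory δ y t⟫_ℂ := by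
  have hfn := continuous_inner_left (ofReal (φ n)) hf
  have hmc := continuous_mode (a := ⟪ofReal (φ n), y₀⟫_ℂ) (hne n) hfn
  rw [inner_memory δ _ hy.cont, memory_congr δ (fun s hs => hy.inner_eq s hs n)]
  refine eq_memory_of_hasDerivAt hmc.continuousOn modeMemory_zero (fun s _ => ?_) ht
  simpa [Complex.real_smul] using hasDerivAt_modeMemory (hne n) hfn s

theorem IsModalSolution.continuous_add_memory (hy : IsModalSolution lam φ δ f y₀ y) :
    Continuous fun s => y (max s 0) + memory δ y s :=
  (continuous_comp_max hy.cont).add (continuous_memory δ hy.cont)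

theorem IsModalSolution.inner_sub_eq (hne : ∀ n, muPlus δ (lam n) - muMinus δ (lam n) ≠ 0)
    (hf : Continuous f) (hy : IsModalSolution lam φ δ f y₀ y) (n : ℕ) {t : ℝ} (ht : 0 ≤ t) :
    ⟪ofReal (φ n), y t⟫_ℂ - ⟪ofReal (φ n), y₀⟫_ℂ
      = ∫ s in (0 : ℝ)..t, (⟪ofReal (φ n), f s⟫_ℂ
        - lam n * ⟪ofReal (φ n), y (max s 0) + memory δ y s⟫_ℂ) := by
  have hfn := continuous_inner_left (ofReal (φ n)) hf
  have hsum := continuous_inner_left (ofReal (φ n)) hy.continuous_add_memory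
  rw [intervalIntegral.integral_eq_sub_of_hasDerivAt
    (f := mode δ (lam n) ⟪ofReal (φ n), y₀⟫_ℂ (fun s => ⟪ofReal (φ n), f s⟫_ℂ))
    (fun s hs => ?_) (Continuous.intervalIntegrable (by fun_prop) _ _), mode_zero (hne n),
    hy.inner_eq t ht]
  rw [Set.uIcc_of_le ht] at hs
  refine (hasDerivAt_mode (hne n) hfn s).congr_deriv ?_
  rw [inner_add_right, max_eq_left hs.1, hy.inner_eq s hs.1, hy.inner_memory_eq hne hf n hs.1]
  ring

theorem IsModalSolution.init (hφ : IsEigenSystem A lam φ) (hA : IsSelfAdjoint A)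
    (hcpt : HasCompactResolvent A) (hne : ∀ n, muPlus δ (lam n) - muMinus δ (lam n) ≠ 0)
    (hy : IsModalSolution lam φ δ f y₀ y) : y 0 = y₀ :=
  eq_of_forall_inner_eq (hφ.basisC hA hcpt) fun n => by
    rw [hφ.coe_basisC, hy.inner_eq 0 le_rfl, mode_zero (hne n)]

/-- By Parseval an identity tested on eigenvectors extends to all of `D(A) + iD(A)`. It expresses `p
+ Aq = 0` weakly, without requiring `q` to lie in the domain. -/
theorem IsEigenSystem.inner_add_inner_eq_zero (hφ : IsEigenSystem A lam φ) (hA : IsSelfAdjoint A)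
    (hcpt : HasCompactResolvent A) {p q : Complexification H}
    (h : ∀ n, ⟪ofReal (φ n), p⟫_ℂ + lam n * ⟪ofReal (φ n), q⟫_ℂ = 0) (x : (mapPMap A).domain) :
    ⟪(x : Complexification H), p⟫_ℂ + ⟪mapPMap A x, q⟫_ℂ = 0 := by
  have hs := ((hφ.basisC hA hcpt).hasSum_inner_mul_inner x p).add
    ((hφ.basisC hA hcpt).hasSum_inner_mul_inner (mapPMap A x) q)
  refine hs.tsum_eq.symm.trans ((tsum_congr fun n => ?_).trans tsum_zero)
  have e : ⟪mapPMap A x, ofReal (φ n)⟫_ℂ = lam n * ⟪(x : Complexification H), ofReal (φ n)⟫_ℂ := by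
    rw [← inner_conj_symm, hφ.inner_mapPMap hA, map_mul, Complex.conj_ofReal, inner_conj_symm]
  rw [hφ.coe_basisC, e]
  linear_combination ⟪(x : Complexification H), ofReal (φ n)⟫_ℂ * h n

theorem IsModalSolution.isWeakSolution (hφ : IsEigenSystem A lam φ) (hA : IsSelfAdjoint A)
    (hcpt : HasCompactResolvent A) (hβ : ∀ t, β t = Real.exp (-δ * t))
    (hne : ∀ n, muPlus δ (lam n) - muMinus δ (lam n) ≠ 0)
    (hf : Continuous fun t => mapCLM B (u t))
    (hy : IsModalSolution lam φ δ (fun t => mapCLM B (u t)) y₀ y) :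
    IsWeakSolution A B β u y₀ y := by
  refine ⟨hy.cont, hy.init hφ hA hcpt hne, fun x t ht => ?_⟩
  have hsum := hy.continuous_add_memory
  have hG : Continuous fun s => ⟪(x : Complexification H), mapCLM B (u s)⟫_ℂ
      - ⟪mapPMap A x, y (max s 0) + memory δ y s⟫_ℂ :=
    (continuous_inner_left _ hf).sub (continuous_inner_left _ hsum)
  have key : ∀ s ∈ Set.Ici (0 : ℝ), ⟪(x : Complexification H), y s⟫_ℂ
      = ⟪(x : Complexification H), y₀⟫_ℂ
        + ∫ r in (0 : ℝ)..s, (⟪(x : Complexification H), mapCLM B (u r)⟫_ℂ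
          - ⟪mapPMap A x, y (max r 0) + memory δ y r⟫_ℂ) := by
    intro s hs
    -- The time-integrated equation is extended from eigenvectors to `x` and differentiated only
    -- afterwards; a series of derivatives would need control of `λ_n y_n`.
    have h0 := hφ.inner_add_inner_eq_zero hA hcpt (p := y s - y₀ - ∫ r in (0 : ℝ)..s, mapCLM B (u r))
      (q := ∫ r in (0 : ℝ)..s, (y (max r 0) + memory δ y r)) (fun n => ?_) x
    · rw [intervalIntegral.integral_sub ((continuous_inner_left _ hf).intervalIntegrable _ _)
        ((continuous_inner_left _ hsum).intervalIntegrable _ _), ← inner_intervalIntegral _ hf,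
        ← inner_intervalIntegral _ hsum]
      rw [inner_sub_right, inner_sub_right] at h0
      linear_combination h0
    · have h1 := hy.inner_sub_eq hne hf n hs
      have h2 : Continuous fun r => (lam n : ℂ) * ⟪ofReal (φ n), y (max r 0) + memory δ y r⟫_ℂ :=
        continuous_const.mul (continuous_inner_left _ hsum)
      rw [intervalIntegral.integral_sub ((continuous_inner_left _ hf).intervalIntegrable _ _)
        (h2.intervalIntegrable _ _), intervalIntegral.integral_const_mul, ← inner_intervalIntegral _ hf,
        ← inner_intervalIntegral _ hsum] at h1
      rw [inner_sub_right, inner_sub_right]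
      linear_combination h1
  have hd := (hG.integral_hasStrictDerivAt 0 t).hasDerivAt.const_add ⟪(x : Complexification H), y₀⟫_ℂ
  refine (hd.hasDerivWithinAt.congr (s := Set.Ici 0) key (key t ht)).congr_deriv ?_
  rw [integral_mul_inner_eq_memory hβ _ ht, ← inner_memory δ _ hy.cont, max_eq_left ht,
    inner_add_right]
  ring

/-- The summable majorant makes `Ay` a continuous function `z`; the equation then holds in
integrated form in `H + iH`, and its continuous integrand gives `y ∈ C¹`. -/
theorem IsModalSolution.isClassicalSolution (hφ : IsEigenSystem A lam φ) (hA : IsSelfAdjoint A)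
    (hcpt : HasCompactResolvent A) (hβ : ∀ t, β t = Real.exp (-δ * t))
    (hne : ∀ n, muPlus δ (lam n) - muMinus δ (lam n) ≠ 0)
    (hf : Continuous fun t => mapCLM B (u t))
    (hy : IsModalSolution lam φ δ (fun t => mapCLM B (u t)) y₀ y) {c : ℕ → ℝ}
    (hc : Summable fun n => c n ^ 2)
    (hle : ∀ n t, 0 ≤ t → ‖(lam n : ℂ) * ⟪ofReal (φ n), y t⟫_ℂ‖ ≤ c n) :
    IsClassicalSolution A B β u y₀ y := by
  obtain ⟨z, hz, hz'⟩ := exists_continuousOn_inner_eq (hφ.basisC hA hcpt) (s := Set.Ici 0)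
    (Y := fun n t => (lam n : ℂ) * ⟪ofReal (φ n), y t⟫_ℂ) hc
    (fun n => continuousOn_const.mul (continuousOn_const.inner hy.cont)) hle
  simp only [hφ.coe_basisC] at hz'
  have hg : Continuous fun s => mapCLM B (u s) - z (max s 0) - memory δ z s :=
    (hf.sub (continuous_comp_max hz)).sub (continuous_memory δ hz)
  have hinner (n : ℕ) {t : ℝ} (ht : 0 ≤ t) :
      ⟪ofReal (φ n), memory δ z t⟫_ℂ = lam n * ⟪ofReal (φ n), memory δ y t⟫_ℂ := by
    have h1 := inner_memory δ ((lam n : ℂ) • ofReal (φ n)) hy.cont t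
    rw [inner_smul_left, Complex.conj_ofReal] at h1
    rw [h1, inner_memory δ _ hz]
    refine memory_congr δ (fun s hs => ?_) t
    rw [hz' s hs, inner_smul_left, Complex.conj_ofReal]
  have key : ∀ t ∈ Set.Ici (0 : ℝ), y t
      = y₀ + ∫ s in (0 : ℝ)..t, (mapCLM B (u s) - z (max s 0) - memory δ z s) := by
    intro t ht
    refine eq_of_forall_inner_eq (hφ.basisC hA hcpt) fun n => ?_
    rw [hφ.coe_basisC, inner_add_right, ← sub_eq_iff_eq_add', inner_intervalIntegral _ hg,
      hy.inner_sub_eq hne hf n ht]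
    refine intervalIntegral.integral_congr fun s hs => ?_
    rw [Set.uIcc_of_le ht] at hs
    simp only [inner_sub_right, inner_add_right, max_eq_left hs.1, hinner n hs.1, hz' s hs.1]
    ring
  have hd : ∀ t, 0 ≤ t →
      HasDerivWithinAt y (mapCLM B (u t) - z (max t 0) - memory δ z t) (Set.Ici 0) t := by
    intro t ht
    have h1 := (hg.integral_hasStrictDerivAt 0 t).hasDerivAt.const_add y₀
    exact h1.hasDerivWithinAt.congr key (key t ht)
  refine ⟨hy.init hφ hA hcpt hne, ?_, z, hz, fun t ht => ⟨?_, ?_⟩⟩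
  · rw [contDiffOn_one_iff_derivWithin (uniqueDiffOn_Ici 0)]
    refine ⟨fun t ht => (hd t ht).differentiableWithinAt, hg.continuousOn.congr fun t ht => ?_⟩
    exact (hd t ht).derivWithin (uniqueDiffOn_Ici 0 t ht)
  · exact hφ.mem_mapPMap_domain hA hcpt fun n => hz' t ht n
  · rw [integral_smul_eq_memory hβ z ht]
    simpa only [max_eq_left ht] using hd t ht

end Solutions

/-! ### Decay and regularity from the moment conditions. -/

section Stabilization

variable {H : Type*} [NormedAddCommGroup H] [InnerProductSpace ℝ H] [CompleteSpace H]
  {A : H →ₗ.[ℝ] H} {B : H →L[ℝ] H} {lam : ℕ → ℝ} {φ : ℕ → H} {δ : ℝ} {β : ℝ → ℝ}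
  {u : ℝ → Complexification H} {y₀ : Complexification H} {y : ℝ → Complexification H}

theorem summable_sq_add {f g : ℕ → ℝ} (hf : Summable fun n => f n ^ 2)
    (hg : Summable fun n => g n ^ 2) : Summable fun n => (f n + g n) ^ 2 :=
  ((hf.add hg).mul_left 2).of_nonneg_of_le (fun _ => sq_nonneg _) fun n => by
    nlinarith [sq_nonneg (f n - g n)]

theorem summable_sq_const_mul {f : ℕ → ℝ} (c : ℝ) (hf : Summable fun n => f n ^ 2) :
    Summable fun n => (c * f n) ^ 2 := by
  simpa only [mul_pow] using hf.mul_left (c ^ 2)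

theorem tsum_sq_add_le {f g : ℕ → ℝ} (hf : Summable fun n => f n ^ 2)
    (hg : Summable fun n => g n ^ 2) :
    ∑' n, (f n + g n) ^ 2 ≤ 2 * (∑' n, f n ^ 2 + ∑' n, g n ^ 2) := by
  rw [← hf.tsum_add hg, ← tsum_mul_left]
  exact (summable_sq_add hf hg).tsum_le_tsum
    (fun n => by nlinarith [sq_nonneg (f n - g n)]) ((hf.add hg).mul_left 2)

theorem norm_duhamel_le_of_moment {μ a : ℂ} {f : ℝ → ℂ} {F T γ t : ℝ} (hT : 0 < T) (hγ : 0 < γ)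
    (hμ : 0 < μ.re) (hf : Continuous f) (hF : ∀ s, ‖f s‖ ≤ F) (hs : ∀ s, T ≤ s → f s = 0)
    (hmom : γ ≤ μ.re ∨ a + ∫ s in (0 : ℝ)..T, Complex.exp (μ * s) * f s = 0) (ht : 0 ≤ t) :
    ‖duhamel μ a f t‖ ≤ Real.exp (-γ * t) * (Real.exp (γ * T) * (‖a‖ + T * F)) := by
  have hF0 : 0 ≤ F := (norm_nonneg _).trans (hF 0)
  rcases hmom with h | h
  · exact norm_duhamel_le_exp hT hγ.le h hf hF hs ht
  · rcases le_total T t with hTt | htT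
    · rw [duhamel_of_le hf hs hTt, h, mul_zero, norm_zero]
      positivity
    · have h1 := norm_duhamel_le_exp (a := a) hT le_rfl hμ.le hf hF hs ht
      simp only [neg_zero, zero_mul, Real.exp_zero, one_mul] at h1
      rw [← mul_assoc, ← Real.exp_add]
      exact h1.trans (le_mul_of_one_le_left (by positivity) (Real.one_le_exp (by nlinarith)))

theorem hasSum_sq_norm_inner_ofReal (hφ : IsEigenSystem A lam φ) (hA : IsSelfAdjoint A)
    (hcpt : HasCompactResolvent A) (x : Complexification H) :
    HasSum (fun n => ‖⟪ofReal (φ n), x⟫_ℂ‖ ^ 2) (‖x‖ ^ 2) := by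
  simpa only [hφ.coe_basisC] using hasSum_sq_norm_inner (hφ.basisC hA hcpt) x

/-- A control whose moments annihilate all modes that do not decay at the rate `γ` stabilizes. -/
theorem steers_of_moments (hφ : IsEigenSystem A lam φ) (hA : IsSelfAdjoint A)
    (hpos : PositiveDefinite A) (hcpt : HasCompactResolvent A) (hδ : 0 < δ)
    (hβ : ∀ t, β t = Real.exp (-δ * t))
    (hne : ∀ n, muPlus δ (lam n) - muMinus δ (lam n) ≠ 0) {γ T C₀ K : ℝ} (hγ : 0 < γ) (hT : 0 < T)
    (hK : 0 ≤ K) (hC₀ : 0 < C₀)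
    (hcoef : ∀ n, ‖coefPlus δ (lam n)‖ ≤ C₀ ∧ (1 + lam n) * ‖coefMinus δ (lam n)‖ ≤ C₀ ∧
      lam n / (muPlus δ (lam n)).re ≤ C₀)
    (hf : Continuous fun t => mapCLM B (u t)) (hfT : ∀ t, T ≤ t → mapCLM B (u t) = 0) {F : ℕ → ℝ}
    (hF : ∀ n t, ‖⟪ofReal (φ n), mapCLM B (u t)⟫_ℂ‖ ≤ F n) (hFs : Summable fun n => F n ^ 2)
    (hFK : ∑' n, F n ^ 2 ≤ (K * ‖y₀‖) ^ 2)
    (hmom : ∀ n, γ ≤ (muMinus δ (lam n)).re ∨ ∀ μ : ℂ, μ * (μ - δ) = lam n * (μ - 1 - δ) →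
      ⟪ofReal (φ n), y₀⟫_ℂ
        + ∫ s in (0 : ℝ)..T, Complex.exp (μ * s) * ⟪ofReal (φ n), mapCLM B (u s)⟫_ℂ = 0) :
    Steers A B β γ (4 * C₀ * Real.exp (γ * T) * (1 + T * K)) y₀ u := by
  have hlam := hφ.pos hpos
  have hfn (n : ℕ) := continuous_inner_left (ofReal (φ n)) hf
  have hfnT (n : ℕ) : ∀ t, T ≤ t → ⟪ofReal (φ n), mapCLM B (u t)⟫_ℂ = 0 := fun t ht => by
    rw [hfT t ht, inner_zero_right]
  have hminus (n : ℕ) : 0 < (muMinus δ (lam n)).re := muMinus_re_pos hδ (hlam n)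
  have hplus (n : ℕ) : 0 < (muPlus δ (lam n)).re :=
    (hminus n).trans_le (muMinus_re_le_muPlus_re _ _)
  have hF0 (n : ℕ) : 0 ≤ F n := (norm_nonneg _).trans (hF n 0)
  have hcm (n : ℕ) : ‖coefMinus δ (lam n)‖ ≤ C₀ := by
    have := (hcoef n).2.1
    nlinarith [norm_nonneg (coefMinus δ (lam n)), hlam n]
  have has := hasSum_sq_norm_inner_ofReal hφ hA hcpt y₀
  set a : ℕ → ℂ := fun n => ⟪ofReal (φ n), y₀⟫_ℂ with ha
  set f : ℕ → ℝ → ℂ := fun n s => ⟪ofReal (φ n), mapCLM B (u s)⟫_ℂ with hfdef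
  -- Two exponentials, each with coefficient at most `C₀`.
  set D := 2 * C₀ * Real.exp (γ * T) with hD
  have hD0 : 0 ≤ D := by positivity
  have hsumTF : Summable fun n => (T * F n) ^ 2 := summable_sq_const_mul T hFs
  have hbase : Summable fun n => (‖a n‖ + T * F n) ^ 2 := summable_sq_add has.summable hsumTF
  have hmode (n : ℕ) (t : ℝ) (ht : 0 ≤ t) :
      ‖mode δ (lam n) (a n) (f n) t‖ ≤ Real.exp (-γ * t) * D * (‖a n‖ + T * F n) := by
    have hp := norm_duhamel_le_of_moment (a := a n) hT hγ (hplus n) (hfn n) (hF n) (hfnT n)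
      ((hmom n).imp (fun h => h.trans (muMinus_re_le_muPlus_re _ _))
        fun h => h _ (muPlus_quadratic _ _)) ht
    have hm := norm_duhamel_le_of_moment (a := a n) hT hγ (hminus n) (hfn n) (hF n) (hfnT n)
      ((hmom n).imp id fun h => h _ (muMinus_quadratic _ _)) ht
    have h1 := mul_le_mul (hcoef n).1 hp (norm_nonneg _) hC₀.le
    have h2 := mul_le_mul (hcm n) hm (norm_nonneg _) hC₀.le
    refine (norm_add_le _ _).trans ?_
    rw [norm_mul, norm_mul]
    refine (add_le_add h1 h2).trans (le_of_eq ?_)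
    rw [hD]; ring
  obtain ⟨y, hyc, hyi⟩ := exists_continuousOn_inner_eq (hφ.basisC hA hcpt) (s := Set.Ici 0)
    (Y := fun n => mode δ (lam n) (a n) (f n)) (c := fun n => D * (‖a n‖ + T * F n))
    (summable_sq_const_mul D hbase)
    (fun n => (continuous_mode (hne n) (hfn n)).continuousOn) fun n t ht => by
      refine (hmode n t ht).trans ?_
      rw [mul_assoc]
      refine mul_le_of_le_one_left (mul_nonneg hD0 (by have := hF0 n; positivity)) ?_
      rw [Real.exp_le_one_iff]
      nlinarith [Set.mem_Ici.1 ht]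
  simp only [hφ.coe_basisC] at hyi
  have hy : IsModalSolution lam φ δ (fun t => mapCLM B (u t)) y₀ y := ⟨hyc, hyi⟩
  have hweak := hy.isWeakSolution hφ hA hcpt hβ hne hf
  refine ⟨y, hweak, fun y' hy' => hweak.eqOn hφ hA hcpt hβ hy', fun hdom => ?_, fun t ht => ?_⟩
  · have hAs := hasSum_sq_norm_inner_ofReal hφ hA hcpt (mapPMap A ⟨y₀, hdom⟩)
    have hla (n : ℕ) : ‖⟪ofReal (φ n), mapPMap A ⟨y₀, hdom⟩⟫_ℂ‖ = lam n * ‖a n‖ := by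
      rw [hφ.inner_mapPMap hA, norm_mul, Complex.norm_real, Real.norm_of_nonneg (hlam n).le]
    simp only [hla] at hAs
    refine hy.isClassicalSolution hφ hA hcpt hβ hne hf
      -- The first summand bounds the `μ^+` part through `λ_n / Re μ^+ ≤ C₀`, the second the `μ^-`
      -- part through `λ_n |coefMinus| ≤ C₀`. Only the data is multiplied by `λ_n`, and `λ_n |a_n|`
      -- is square summable since `y₀` is in the domain.
      (c := fun n => C₀ * (lam n * ‖a n‖ + C₀ * F n) + C₀ * (‖a n‖ + T * F n))
      (summable_sq_add (summable_sq_const_mul _ (summable_sq_add hAs.summable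
        (summable_sq_const_mul _ hFs))) (summable_sq_const_mul _ hbase)) fun n t ht => ?_
    rw [hyi t ht n, mode, mul_add]
    have hp := norm_duhamel_le (a := a n) (hplus n) (hF n) ht
    have hm := norm_duhamel_le_exp (a := a n) hT le_rfl (hminus n).le (hfn n) (hF n) (hfnT n) ht
    simp only [neg_zero, zero_mul, Real.exp_zero, one_mul] at hm
    refine (norm_add_le _ _).trans (add_le_add ?_ ?_)
    · rw [norm_mul, norm_mul, Complex.norm_real, Real.norm_of_nonneg (hlam n).le, mul_left_comm]
      refine mul_le_mul (hcoef n).1 ?_ (by have := hlam n; positivity) hC₀.le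
      refine (mul_le_mul_of_nonneg_left hp (hlam n).le).trans ?_
      rw [mul_add]
      refine add_le_add le_rfl ?_
      calc lam n * (F n / (muPlus δ (lam n)).re) = lam n / (muPlus δ (lam n)).re * F n := by ring
        _ ≤ C₀ * F n := mul_le_mul_of_nonneg_right (hcoef n).2.2 (hF0 n)
    · rw [norm_mul, norm_mul, Complex.norm_real, Real.norm_of_nonneg (hlam n).le, ← mul_assoc]
      refine mul_le_mul ?_ hm (norm_nonneg _) hC₀.le
      have := (hcoef n).2.1
      nlinarith [norm_nonneg (coefMinus δ (lam n))]
  · have hle := norm_sq_le_tsum (hφ.basisC hA hcpt) (x := y t)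
      (d := fun n => Real.exp (-γ * t) * D * (‖a n‖ + T * F n))
      (summable_sq_const_mul _ hbase) fun n => by
        rw [hφ.coe_basisC, hyi t ht n]; exact hmode n t ht
    have h1 := tsum_sq_add_le has.summable hsumTF
    simp_rw [mul_pow (Real.exp (-γ * t) * D)] at hle
    rw [tsum_mul_left] at hle
    rw [has.tsum_eq] at h1
    simp_rw [mul_pow T] at h1
    rw [tsum_mul_left] at h1
    refine abs_le_of_sq_le_sq' ?_ (by positivity) |>.2
    refine hle.trans ?_
    -- The estimate `2(1 + T²K²) ≤ (2(1 + TK))²` contributes a factor `2`, which with the `2` in `D`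
    -- makes the `4` of the constant.
    calc (Real.exp (-γ * t) * D) ^ 2 * ∑' n, (‖a n‖ + T * F n) ^ 2
        ≤ (Real.exp (-γ * t) * D) ^ 2 * (2 * (1 + T * K) * ‖y₀‖) ^ 2 := by
          refine mul_le_mul_of_nonneg_left ?_ (sq_nonneg _)
          have h2 : T ^ 2 * ∑' n, F n ^ 2 ≤ T ^ 2 * (K * ‖y₀‖) ^ 2 :=
            mul_le_mul_of_nonneg_left hFK (sq_nonneg _)
          have h3 : 0 ≤ T * K * ‖y₀‖ ^ 2 := by positivity
          have h4 : 0 ≤ (T * K * ‖y₀‖) ^ 2 := sq_nonneg _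
          nlinarith [sq_nonneg ‖y₀‖]
      _ = _ := by rw [hD]; ring

end Stabilization

/-! ### Consequences of the rank condition. -/

section Rank

variable {H : Type*} [NormedAddCommGroup H] [InnerProductSpace ℝ H]
  {B : H →L[ℝ] H} {lam : ℕ → ℝ} {φs : ℕ → H} {δ : ℝ} {N M : ℕ}
  {R : Matrix (Fin N ⊕ Fin N) (Fin N ⊕ Fin N) ℂ}

/-- The left eigenvectors of `P` for `-μ⁺` are supported in one eigenvalue block. -/
theorem apply_inl_inr_eq_zero (hδ : 0 < δ) (hRP : R * matP δ lam N = matD δ lam N * R)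
    {k m : Fin N} (h : lam m ≠ lam k) : R (Sum.inl k) (Sum.inr m) = 0 := by
  have h1 := congrFun (congrFun hRP (Sum.inl k)) (Sum.inl m)
  have h2 := congrFun (congrFun hRP (Sum.inl k)) (Sum.inr m)
  rw [matD, Matrix.diagonal_mul] at h1 h2
  simp only [matP, Matrix.mul_apply, Fintype.sum_sum_type,
    Matrix.fromBlocks_apply₁₁, Matrix.fromBlocks_apply₂₁, Matrix.fromBlocks_apply₁₂,
    Matrix.fromBlocks_apply₂₂, Matrix.zero_apply, Matrix.neg_apply, Matrix.diagonal_apply,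
    Matrix.one_apply, Sum.elim_inl, mul_zero, Finset.sum_const_zero, zero_add, mul_neg, mul_ite,
    mul_one, Finset.sum_neg_distrib, Finset.sum_ite_eq', Finset.mem_univ, if_true] at h1 h2
  push_cast at h1 h2
  by_contra h0
  -- Eliminating the first-half entry from the two equations of the left eigenvector leaves the
  -- characteristic equation of `lam m` at `μ = μ_k^+`, times the entry in question. If that entry
  -- were nonzero, `μ` would belong to both eigenvalues.
  refine h (eq_of_quadratic hδ (μ := muPlus δ (lam k)) ?_ (muPlus_quadratic δ (lam k)))
  refine mul_left_cancel₀ h0 ?_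
  linear_combination -h1 + muPlus δ (lam k) * h2

open scoped ComplexOrder in
/-- Under the rank condition the control reaches the components of each eigenvalue block
independently of one another. -/
theorem RankCondition.exists_mulVec_eq (hδ : 0 < δ) (hR : IsUnit R)
    (hRP : matP δ lam N = R⁻¹ * matD δ lam N * R) (h : RankCondition B lam φs N M R) (j : Fin N) :
    ∃ U : Fin M → ℂ, ∀ k : Fin N, lam k = lam j →
      (matC B φs N M).mulVec U k = if k = j then 1 else 0 := by
  classical
  have hRP' : R * matP δ lam N = matD δ lam N * R := by
    rw [hRP, Matrix.mul_assoc, ← Matrix.mul_assoc R,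
      Matrix.mul_nonsing_inv _ ((Matrix.isUnit_iff_isUnit_det R).1 hR), Matrix.one_mul]
  let ι := {k : Fin N // lam k = lam j}
  let S : Matrix ι ι ℂ := fun k m => R (Sum.inl k.1) (Sum.inr m.1)
  let Cb : Matrix ι (Fin M) ℂ := (matC B φs N M).submatrix Subtype.val id
  -- The upper half of `Q` is zero and the row of `R` lives on one eigenvalue block, so only the
  -- rows `Cb` of `C_{NM}` in this block enter.
  have hfac : (blockPlus (R * matQ B φs N M).conjTranspose lam (lam j)) = (S * Cb).conjTranspose := by
    ext i k
    rw [Matrix.conjTranspose_apply]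
    change star ((R * matQ B φs N M) (Sum.inl k.1) i) = _
    congr 1
    rw [Matrix.mul_apply, Matrix.mul_apply, Fintype.sum_sum_type]
    simp only [matQ, Matrix.fromRows_apply_inl, Matrix.fromRows_apply_inr, Matrix.zero_apply,
      mul_zero, Finset.sum_const_zero, zero_add]
    refine (Finset.sum_filter_of_ne (p := fun m : Fin N => lam m = lam j) fun m _ hm => ?_).symm.trans
      (Finset.sum_subtype _ (by simp) _)
    by_contra hne
    exact hm (by rw [apply_inl_inr_eq_zero hδ hRP' (by rwa [k.2]), zero_mul])
  have hrank : Fintype.card ι ≤ Cb.rank := by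
    have h1 := (h j).1
    rw [mult, Nat.card_eq_fintype_card] at h1
    have h2 : (S * Cb).rank = Fintype.card ι := by
      rw [← Matrix.rank_conjTranspose, ← hfac]
      convert h1
    exact h2 ▸ Matrix.rank_mul_le_right S Cb
  -- Full row rank of `Cb` means that it is surjective; `U` is a preimage of the basis vector at
  -- `j`.
  have htop : LinearMap.range Cb.mulVecLin = ⊤ := by
    refine Submodule.eq_top_of_finrank_eq (le_antisymm (Submodule.finrank_le _) ?_)
    rw [Module.finrank_fintype_fun_eq_card]
    exact hrank
  obtain ⟨U, hU⟩ := LinearMap.range_eq_top.1 htop (Pi.single ⟨j, rfl⟩ 1)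
  refine ⟨U, fun k hk => ?_⟩
  have h1 : (matC B φs N M).mulVec U k = _ := congrFun hU ⟨k, hk⟩
  rw [h1, Pi.single_apply]
  exact if_congr Subtype.ext_iff rfl rfl

end Rank

/-! ### Construction of the control. -/

section SmoothControl

variable {H : Type*} [NormedAddCommGroup H] [InnerProductSpace ℝ H] [CompleteSpace H]
  {A : H →ₗ.[ℝ] H} {B : H →L[ℝ] H} {lam : ℕ → ℝ} {φ : ℕ → H} {δ γ : ℝ} {β : ℝ → ℝ}

theorem mapCLM_control {M : ℕ} (B : H →L[ℝ] H) (Φ : Fin M → H) (v : ℝ → Fin M → ℂ) (t : ℝ) :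
    mapCLM B (control Φ v t) = control (fun i => B (Φ i)) v t := by
  let L : Complexification H →+ Complexification H :=
    ⟨⟨mapCLM B, Complexification.ext (by simp [mapCLM]) (by simp [mapCLM])⟩, fun x y =>
      Complexification.ext (by simp [mapCLM]) (by simp [mapCLM])⟩
  change L (∑ i, v t i • ofReal (Φ i)) = ∑ i, v t i • ofReal (B (Φ i))
  rw [map_sum]
  refine Finset.sum_congr rfl fun i _ => Complexification.ext ?_ ?_
  · change B (_ - _) = _
    simp [ofReal, -Complex.coe_smul]
  · change B (_ + _) = _
    simp [ofReal, -Complex.coe_smul]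

theorem continuous_control {M : ℕ} (Φ : Fin M → H) {v : ℝ → Fin M → ℂ}
    (hv : ∀ i, Continuous fun t => v t i) : Continuous (control Φ v) :=
  continuous_finsetSum _ fun i _ => (hv i).smul continuous_const

theorem inner_control {M : ℕ} (x : Complexification H) (Φ : Fin M → H) (v : ℝ → Fin M → ℂ) (t : ℝ) :
    ⟪x, control Φ v t⟫_ℂ = ∑ i, v t i * ⟪x, ofReal (Φ i)⟫_ℂ := by
  simp only [control, inner_sum, inner_smul_right]

/-- A biorthogonal system of eigenvectors whose index range does not cut an eigenspace. -/
theorem IsEigenSystem.eq_of_biorthogonal (hφ : IsEigenSystem A lam φ) (hA : IsSelfAdjoint A)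
    (hcpt : HasCompactResolvent A) {N : ℕ} (hN : ∀ j n, j < N → lam n = lam j → n < N)
    {φs : ℕ → H} (heig : ∀ j, j < N → IsEigenpair A (lam j) (φs j))
    (hφs : ∀ i j, i < N → j < N → inner ℝ (φ i) (φs j) = if i = j then (1 : ℝ) else 0)
    {j : ℕ} (hj : j < N) : φs j = φ j := by
  refine (hφ.basis hA hcpt).repr.injective (lp.ext (funext fun n => ?_))
  rw [HilbertBasis.repr_apply_apply, HilbertBasis.repr_apply_apply, hφ.coe_basis,
    orthonormal_iff_ite.1 hφ.orthonormal]
  by_cases hn : n < N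
  · exact hφs n j hn hj
  · rw [if_neg (by omega)]
    obtain ⟨h, h'⟩ := heig j hj
    have h1 := hφ.inner_map hA ⟨φs j, h⟩ n
    rw [h', real_inner_smul_right] at h1
    -- Biorthogonality says nothing for `n ≥ N`, but there `λ_n ≠ λ_j`, and eigenvectors of
    -- different eigenvalues are orthogonal.
    have h2 : lam j - lam n ≠ 0 := sub_ne_zero.2 fun e => hn (hN j n hj e.symm)
    exact (mul_eq_zero.1 (show (lam j - lam n) * ⟪φ n, φs j⟫_ℝ = 0 by linarith)).resolve_left h2

theorem exists_norm_deriv_le {θ : ℝ → ℂ} (hθ : ContDiff ℝ ∞ θ) {T : ℝ}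
    (hs : tsupport θ ⊆ Set.Ioo 0 T) :
    ∃ K, 0 ≤ K ∧ ∀ t, ‖θ t‖ ≤ K ∧ ‖deriv θ t‖ ≤ K ∧ ‖deriv (deriv θ) t‖ ≤ K := by
  have h1 : ContDiff ℝ ∞ (deriv θ) := (contDiff_infty_iff_deriv.1 hθ).2
  have h2 : ContDiff ℝ ∞ (deriv (deriv θ)) := (contDiff_infty_iff_deriv.1 h1).2
  have hc : HasCompactSupport θ :=
    HasCompactSupport.of_support_subset_isCompact isCompact_Icc
      ((subset_tsupport θ).trans (hs.trans Set.Ioo_subset_Icc_self))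
  obtain ⟨C₀, h₀⟩ := hc.exists_bound_of_continuous hθ.continuous
  obtain ⟨C₁, h₁⟩ := hc.deriv.exists_bound_of_continuous h1.continuous
  obtain ⟨C₂, h₂⟩ := hc.deriv.deriv.exists_bound_of_continuous h2.continuous
  refine ⟨max C₀ (max C₁ C₂), ((norm_nonneg _).trans (h₀ 0)).trans (le_max_left _ _), fun t =>
    ⟨(h₀ t).trans (le_max_left _ _), (h₁ t).trans ((le_max_left _ _).trans (le_max_right _ _)),
      (h₂ t).trans ((le_max_right _ _).trans (le_max_right _ _))⟩⟩

theorem tsupport_finsetSum_const_mul_subset {ι : Type*} (s : Finset ι) (c : ι → ℂ) {θ : ι → ℝ → ℂ}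
    {S : Set ℝ} (h : ∀ i, tsupport (θ i) ⊆ S) : tsupport (fun t => ∑ i ∈ s, c i * θ i t) ⊆ S := by
  refine (closure_minimal (t := ⋃ i ∈ s, tsupport (θ i)) (fun t ht => ?_)
    (isClosed_biUnion_finset fun i _ => isClosed_tsupport _)).trans
    (Set.iUnion₂_subset fun i _ => h i)
  obtain ⟨i, hi, h0⟩ := Finset.exists_ne_zero_of_sum_ne_zero ht
  exact Set.mem_biUnion hi (subset_tsupport _ (right_ne_zero_of_mul h0))

theorem norm_sum_mul_mul_le {N : ℕ} {a U x : Fin N → ℂ} {p q r : ℝ} (hp : 0 ≤ p)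
    (ha : ∀ j, ‖a j‖ ≤ r) (hU : ∀ j, ‖U j‖ ≤ p) (hx : ∀ j, ‖x j‖ ≤ q) :
    ‖∑ j, -(a j * U j) * x j‖ ≤ N * p * q * r := by
  refine (norm_sum_le_of_le _ (n := fun _ => r * p * q) fun j _ => ?_).trans
    (le_of_eq (by simp; ring))
  rw [norm_mul, norm_neg, norm_mul]
  have := (norm_nonneg _).trans (ha j)
  gcongr
  exacts [ha j, hU j, hx j]

/-- Smooth controls with support in `(0, T)` that stabilize the equation. -/
theorem exists_smooth_control (hφ : IsEigenSystem A lam φ) (hA : IsSelfAdjoint A)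
    (hpos : PositiveDefinite A) (hcpt : HasCompactResolvent A) (hδ : 0 < δ)
    (hβ : ∀ t, β t = Real.exp (-δ * t))
    (hne : ∀ n, muPlus δ (lam n) - muMinus δ (lam n) ≠ 0) (hγ : 0 < γ) {N M : ℕ}
    (hN : ∀ n, N ≤ n → γ ≤ (muMinus δ (lam n)).re) {φs : ℕ → H} (hφs : ∀ j, j < N → φs j = φ j)
    (hU : ∀ j : Fin N, ∃ U : Fin M → ℂ, ∀ k : Fin N, lam k = lam j →
      (matC B φs N M).mulVec U k = if k = j then 1 else 0) {T : ℝ} (hT : 0 < T) :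
    ∃ C, 0 < C ∧ ∀ y₀ : Complexification H, ∃ v : ℝ → Fin M → ℂ,
      (∀ i, ContDiff ℝ ∞ fun t => v t i) ∧ (∀ i, tsupport (fun t => v t i) ⊆ Set.Ioo 0 T) ∧
      (∀ i t, ‖v t i‖ ≤ C * ‖y₀‖ ∧ ‖deriv (fun s => v s i) t‖ ≤ C * ‖y₀‖ ∧
        ‖deriv (deriv fun s => v s i) t‖ ≤ C * ‖y₀‖) ∧
      Steers A B β γ C y₀ (control (fun i : Fin M => φs i) v) := by
  classical
  obtain ⟨C₀, hC₀, hcoef⟩ := exists_coef_bound hδ (hφ.tendsto hcpt)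
  choose U hU using hU
  -- `θ_j` has moment `1` at both roots belonging to `λ_j` and `0` at all other exponents. It
  -- separates eigenvalues; modes with the same eigenvalue are separated by the vectors `U_j`.
  choose θ hθ hθs hθi using fun j : Fin N => exists_contDiff_integral_cexp hT
    (Finset.univ.image (fun k : Fin N => muPlus δ (lam k)) ∪
      Finset.univ.image (fun k : Fin N => muMinus δ (lam k)))
    (fun ν => if ν * (ν - δ) = lam j * (ν - 1 - δ) then 1 else 0)
  choose Kθ hKθ0 hKθ using fun j => exists_norm_deriv_le (hθ j) (hθs j)
  set q := ∑ j, Kθ j with hq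
  have hq0 : 0 ≤ q := Finset.sum_nonneg fun j _ => hKθ0 j
  have hKq (j : Fin N) : Kθ j ≤ q := Finset.single_le_sum (fun i _ => hKθ0 i) (Finset.mem_univ j)
  set p := ∑ j, ∑ i, ‖U j i‖ with hp
  have hp0 : 0 ≤ p := Finset.sum_nonneg fun j _ => Finset.sum_nonneg fun i _ => norm_nonneg _
  have hUp (j : Fin N) (i : Fin M) : ‖U j i‖ ≤ p :=
    (Finset.single_le_sum (f := fun i => ‖U j i‖) (fun i _ => norm_nonneg _)
      (Finset.mem_univ i)).trans (Finset.single_le_sum (f := fun j => ∑ i, ‖U j i‖)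
        (fun j _ => Finset.sum_nonneg fun i _ => norm_nonneg _) (Finset.mem_univ j))
  -- The forces on all modes are dominated by `c |y₀| G n`, square summable because each `B φ_i^*`
  -- lies in the space.
  set G : ℕ → ℝ := fun n => ∑ i : Fin M, ‖⟪ofReal (φ n), ofReal (B (φs i))⟫_ℂ‖ with hG
  have hGs : Summable fun n => G n ^ 2 := by
    refine ((summable_sum (s := Finset.univ) fun (i : Fin M) _ => (hasSum_sq_norm_inner_ofReal hφ hA hcpt
      (ofReal (B (φs i)))).summable).mul_left (M : ℝ)).of_nonneg_of_le (fun n => sq_nonneg _)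
      fun n => ?_
    simpa using sq_sum_le_card_mul_sum_sq (s := Finset.univ)
      (f := fun i : Fin M => ‖⟪ofReal (φ n), ofReal (B (φs i))⟫_ℂ‖)
  set c := (N : ℝ) * p * q with hc
  have hc0 : 0 ≤ c := by positivity
  set K := c * √(∑' n, G n ^ 2) with hK
  have hK0 : 0 ≤ K := by positivity
  set C₁ := 4 * C₀ * Real.exp (γ * T) * (1 + T * K) with hC₁
  have hC₁0 : 0 < C₁ := by positivity
  refine ⟨c + C₁, by positivity, fun y₀ => ?_⟩
  set a : Fin N → ℂ := fun j => ⟪ofReal (φ j), y₀⟫_ℂ with ha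
  have hale (j : Fin N) : ‖a j‖ ≤ ‖y₀‖ := by
    have := norm_inner_le_norm (𝕜 := ℂ) (ofReal (φ j)) y₀
    rwa [(orthonormal_ofReal hφ.orthonormal).1 j, one_mul] at this
  set v : ℝ → Fin M → ℂ := fun t i => ∑ j, -(a j * U j i) * θ j t with hv
  have hvsm (i : Fin M) : ContDiff ℝ ∞ fun t => v t i :=
    ContDiff.sum fun j _ => contDiff_const.mul (hθ j)
  have hvs (i : Fin M) : tsupport (fun t => v t i) ⊆ Set.Ioo 0 T :=
    tsupport_finsetSum_const_mul_subset _ _ hθs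
  have hd1 (j : Fin N) : ContDiff ℝ ∞ (deriv (θ j)) := (contDiff_infty_iff_deriv.1 (hθ j)).2
  have hv1 (i : Fin M) : deriv (fun t => v t i) = fun t => ∑ j, -(a j * U j i) * deriv (θ j) t := by
    ext t
    exact (HasDerivAt.fun_sum fun j _ =>
      (((hθ j).differentiable (by simp) t).hasDerivAt.const_mul _)).deriv
  have hv2 (i : Fin M) :
      deriv (deriv fun t => v t i) = fun t => ∑ j, -(a j * U j i) * deriv (deriv (θ j)) t := by
    ext t
    rw [hv1]
    exact (HasDerivAt.fun_sum fun j _ =>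
      (((hd1 j).differentiable (by simp) t).hasDerivAt.const_mul _)).deriv
  have hvle (i : Fin M) (t : ℝ) : ‖v t i‖ ≤ c * ‖y₀‖ :=
    norm_sum_mul_mul_le hp0 hale (fun j => hUp j i) fun j => ((hKθ j t).1).trans (hKq j)
  have hcC : c * ‖y₀‖ ≤ (c + C₁) * ‖y₀‖ := by gcongr; linarith
  refine ⟨v, hvsm, hvs, fun i t => ⟨(hvle i t).trans hcC, ?_, ?_⟩, ?_⟩
  · rw [hv1]
    exact (norm_sum_mul_mul_le hp0 hale (fun j => hUp j i)
      fun j => ((hKθ j t).2.1).trans (hKq j)).trans hcC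
  · rw [hv2]
    exact (norm_sum_mul_mul_le hp0 hale (fun j => hUp j i)
      fun j => ((hKθ j t).2.2).trans (hKq j)).trans hcC
  have hf : Continuous fun t => mapCLM B (control (fun i : Fin M => φs i) v t) := by
    simp_rw [mapCLM_control]
    exact continuous_control _ fun i => (hvsm i).continuous
  have hst := steers_of_moments (u := control (fun i : Fin M => φs i) v) (y₀ := y₀) hφ hA hpos hcpt
    hδ hβ hne hγ hT hK0 hC₀ hcoef hf (fun t ht => ?_) (F := fun n => c * ‖y₀‖ * G n) (fun n t => ?_)
    (summable_sq_const_mul _ hGs) (le_of_eq ?_) (fun n => ?_)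
  · obtain ⟨y, h1, h2, h3, h4⟩ := hst
    refine ⟨y, h1, h2, h3, fun t ht => (h4 t ht).trans ?_⟩
    gcongr
    linarith
  · rw [mapCLM_control, control]
    refine Finset.sum_eq_zero fun i _ => ?_
    rw [eq_zero_of_tsupport_subset_Ioo (hvs i) (t := t) (by simp [ht]), zero_smul]
  · rw [mapCLM_control, inner_control, hG, Finset.mul_sum]
    refine norm_sum_le_of_le _ fun i _ => ?_
    rw [norm_mul]
    exact mul_le_mul_of_nonneg_right (hvle i t) (norm_nonneg _)
  · have hS := Real.sq_sqrt (show 0 ≤ ∑' n, G n ^ 2 from tsum_nonneg fun n => sq_nonneg (G n))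
    simp_rw [mul_pow (c * ‖y₀‖)]
    rw [tsum_mul_left, hK]
    linear_combination -(c * ‖y₀‖) ^ 2 * hS
  · rcases le_or_gt N n with hn | hn
    · exact Or.inl (hN n hn)
    · refine Or.inr fun μ hμ => ?_
      set k : Fin N := ⟨n, hn⟩ with hk
      have hmem : μ ∈ Finset.univ.image (fun k : Fin N => muPlus δ (lam k)) ∪
          Finset.univ.image (fun k : Fin N => muMinus δ (lam k)) := by
        -- Only `μ_n^±` solve the characteristic equation, so `μ` is among the exponents at which
        -- the moments were prescribed.
        have hroot : (μ - muPlus δ (lam n)) * (μ - muMinus δ (lam n)) = 0 := by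
          have hD := complexSqrt_mul_self ((lam n - δ) ^ 2 - 4 * lam n)
          unfold muPlus muMinus
          push_cast at hD ⊢
          linear_combination hμ - hD / 4
        rcases mul_eq_zero.1 hroot with h | h
        · exact Finset.mem_union_left _ (Finset.mem_image.2 ⟨k, Finset.mem_univ _, (sub_eq_zero.1 h).symm⟩)
        · exact Finset.mem_union_right _ (Finset.mem_image.2 ⟨k, Finset.mem_univ _, (sub_eq_zero.1 h).symm⟩)
      have hmode (s : ℝ) : ⟪ofReal (φ n), mapCLM B (control (fun i : Fin M => φs i) v s)⟫_ℂ
          = ∑ j, -(a j * (matC B φs N M).mulVec (U j) k) * θ j s := by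
        rw [mapCLM_control, inner_control]
        simp only [hv, Matrix.mulVec, dotProduct, Finset.sum_mul, Finset.mul_sum,
          ← Finset.sum_neg_distrib]
        rw [Finset.sum_comm]
        refine Finset.sum_congr rfl fun j _ => Finset.sum_congr rfl fun i _ => ?_
        have hin : ⟪ofReal (φ n), ofReal (B (φs i))⟫_ℂ = matC B φs N M k i := by
          rw [inner_ofReal, matC, Matrix.of_apply, real_inner_comm]
          apply Complex.ext <;> simp [ofReal, hk, hφs n hn]
        rw [hin]; ring
      have hθc (j : Fin N) : Continuous (θ j) := (hθ j).continuous
      simp_rw [hmode, Finset.mul_sum, mul_left_comm (Complex.exp _)]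
      rw [intervalIntegral.integral_finsetSum fun j _ =>
        Continuous.intervalIntegrable (by fun_prop) _ _]
      simp_rw [intervalIntegral.integral_const_mul]
      rw [Finset.sum_eq_single k]
      · rw [hθi k μ hmem, if_pos hμ, hU k k rfl, if_pos rfl]
        simp [ha, hk]
      · intro j _ hj
        rw [hθi j μ hmem]
        -- If `μ` also solves the equation of `λ_j`, the eigenvalues agree and `U_j` does not act on
        -- mode `k`; otherwise the moment of `θ_j` at `μ` is zero.
        split_ifs with h
        · rw [hU j k (eq_of_quadratic hδ hμ h), if_neg hj.symm, mul_zero, neg_zero, zero_mul]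
        · rw [mul_zero]
      · exact fun h => absurd (Finset.mem_univ k) h

end SmoothControl

/-! ### The memory form of the control and the three claims. -/

theorem Steers.mono {H : Type*} [NormedAddCommGroup H] [InnerProductSpace ℝ H]
    {A : H →ₗ.[ℝ] H} {B : H →L[ℝ] H} {β : ℝ → ℝ} {γ C C' : ℝ} {y₀ : Complexification H}
    {u : ℝ → Complexification H} (h : Steers A B β γ C y₀ u) (hC : C ≤ C') :
    Steers A B β γ C' y₀ u := by
  obtain ⟨y, h1, h2, h3, h4⟩ := h
  refine ⟨y, h1, h2, h3, fun t ht => (h4 t ht).trans ?_⟩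
  gcongr

/-- With `w = v' + δv` one has `(e^{δs} v)' = e^{δs} w`; integration from `t` to `T` and `v(T) = 0`
give the formula. -/
theorem eq_neg_integral_of_hasDerivAt {δ T : ℝ} {β : ℝ → ℝ} (hβ : ∀ t, β t = Real.exp (-δ * t))
    {v v' : ℝ → ℂ} (hv : ∀ s, HasDerivAt v (v' s) s) (hv' : Continuous v') (hT : v T = 0) (t : ℝ) :
    v t = -∫ s in t..T, (β (t - s) : ℂ) * (v' s + δ * v s) := by
  have hβc (s : ℝ) : (β (t - s) : ℂ) = Complex.exp (-δ * t) * Complex.exp (δ * s) := by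
    rw [hβ, ← Complex.exp_add, Complex.ofReal_exp]
    congr 1
    push_cast
    ring
  have hvc : Continuous v := continuous_iff_continuousAt.2 fun s => (hv s).continuousAt
  simp_rw [hβc]
  rw [intervalIntegral.integral_eq_sub_of_hasDerivAt
    (f := fun s : ℝ => Complex.exp (-δ * t) * (Complex.exp (δ * s) * v s)) (fun s _ => ?_)
    (Continuous.intervalIntegrable (by fun_prop) _ _), hT, ← mul_assoc (Complex.exp _) _ (v t),
    ← Complex.exp_add]
  · simp
  · refine (((hasDerivAt_cexp_mul (δ : ℂ) s).mul (hv s)).const_mul _).congr_deriv ?_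
    ring

end PIDE

end

open PIDE
theorem mainTheorem4
    {H : Type*} [NormedAddCommGroup H] [InnerProductSpace ℝ H] [CompleteSpace H]
    (A : H →ₗ.[ℝ] H) (hA_dense : Dense (A.domain : Set H)) (hA_closed : A.IsClosed)
    (hA_sa : IsSelfAdjoint A) (hA_pos : PositiveDefinite A) (hA_cpt : HasCompactResolvent A)
    (lam : ℕ → ℝ) (φ : ℕ → H) (hφ : IsEigenSystem A lam φ)
    (B : H →L[ℝ] H)
    (δ : ℝ) (hδ : 0 < δ)
    (β : ℝ → ℝ) (hβ : ∀ t : ℝ, HasDerivAt β (-δ * β t) t) (hβ0 : β 0 = 1)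
    -- standing assumptions: no double roots, and no coincidences `μ_j^+ = μ_m^-`
    (hδ_ne : ∀ j, δ ≠ lam j + 2 * Real.sqrt (lam j) ∧ δ ≠ lam j - 2 * Real.sqrt (lam j))
    (h_sep : ∀ j m, j ≠ m → muPlus δ (lam j) ≠ muMinus δ (lam m))
    (γ : ℝ) (hγ : 0 < γ) (hγ' : γ < δ + 1)
    (N M : ℕ) (hN : N = unstableDim δ γ lam) (hM : M = maxMult lam N)
    -- a system of eigenfunctions biorthogonal to the first `N` ones
    (φs : ℕ → H) (hφs_eig : ∀ j, j < N → IsEigenpair A (lam j) (φs j))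
    (hφs : ∀ i j, i < N → j < N → inner ℝ (φ i) (φs j) = if i = j then (1 : ℝ) else 0)
    (h_semisimple : ∀ j, j < N →
      SemisimpleAt (matP δ lam N) (-muPlus δ (lam j)) ∧
      SemisimpleAt (matP δ lam N) (-muMinus δ (lam j)))
    -- diagonalization of `P_{2N}`, and the rank condition
    (R : Matrix (Fin N ⊕ Fin N) (Fin N ⊕ Fin N) ℂ) (hR : IsUnit R)
    (hRP : matP δ lam N = R⁻¹ * matD δ lam N * R)
    (h_rank : RankCondition B lam φs N M R) :
    -- a controller of the form `u = ∑ i, v_i φ_i^*` stabilizes the system exponentially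
    (∃ C : ℝ, 0 < C ∧ ∀ y₀ : Complexification H, ∃ v : ℝ → Fin M → ℂ,
      ContinuousOn v (Set.Ici 0) ∧
      Steers A B β γ C y₀ (control (fun i : Fin M => φs i) v)) ∧
    -- it can be chosen to vanish after a given time `T`
    (∀ T : ℝ, 0 < T → ∃ C : ℝ, 0 < C ∧ ∀ y₀ : Complexification H,
      ∃ v w : ℝ → Fin M → ℂ,
        ContinuousOn v (Set.Ico 0 T) ∧ ContinuousOn w (Set.Ico 0 T) ∧
        (∀ i, MeasureTheory.MemLp (fun t => w t i) 2
          (MeasureTheory.volume.restrict (Set.Ioo 0 T))) ∧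
        (∀ i, ∀ t ∈ Set.Ico 0 T, v t i = -∫ s in t..T, (β (t - s) : ℂ) * w s i) ∧
        (∀ i, ∫ t in (0 : ℝ)..T, ‖w t i‖ ^ 2 ≤ C * ‖y₀‖ ^ 2) ∧
        (∀ i, ∀ t, T ≤ t → v t i = 0 ∧ w t i = 0) ∧
        Steers A B β γ C y₀ (control (fun i : Fin M => φs i) v)) ∧
    -- it can also be chosen of class `C²` on `[0,∞)` with exponential decay
    (∃ C : ℝ, 0 < C ∧ ∀ y₀ : Complexification H, ∃ v : ℝ → Fin M → ℂ,
      (∀ j, ContDiffOn ℝ 2 (fun t => v t j) (Set.Ici 0)) ∧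
      (∀ j, ∀ t : ℝ, 0 < t →
        ‖v t j‖ + ‖deriv (fun s => v s j) t‖ + ‖deriv (deriv fun s => v s j) t‖
          ≤ C * Real.exp (-γ * t) * ‖y₀‖) ∧
      Steers A B β γ C y₀ (control (fun i : Fin M => φs i) v)) := by 
  have hlim := hφ.tendsto hA_cpt
  have hβe := eq_exp_of_hasDerivAt hβ hβ0
  have hne (n : ℕ) := muPlus_sub_muMinus_ne_zero (hφ.pos hA_pos n) (hδ_ne n)
  have hN' (n : ℕ) (hn : N ≤ n) : γ ≤ (muMinus δ (lam n)).re :=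
    (lt_muMinus_re_of_unstableDim_le hδ (by linarith) hlim (hN ▸ hn)).le
  have hcut (j n : ℕ) (hj : j < N) (h : lam n = lam j) : n < N :=
    hN ▸ lt_unstableDim_of_eq hδ (by linarith) hlim hφ.mono (hN ▸ hj) h
  have hφs' (j : ℕ) (hj : j < N) : φs j = φ j :=
    hφ.eq_of_biorthogonal hA_sa hA_cpt hcut hφs_eig hφs hj
  have key (T : ℝ) (hT : 0 < T) := exists_smooth_control (B := B) (γ := γ) hφ hA_sa hA_pos hA_cpt hδ
    hβe hne hγ hN' hφs' (fun j => h_rank.exists_mulVec_eq hδ hR hRP j) hT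
  refine ⟨?_, fun T hT => ?_, ?_⟩
  -- The horizon `1` is arbitrary.
  · obtain ⟨C, hC, h⟩ := key 1 one_pos
    refine ⟨C, hC, fun y₀ => ?_⟩
    obtain ⟨v, hv, -, -, hs⟩ := h y₀
    exact ⟨v, (continuous_pi fun i => (hv i).continuous).continuousOn, hs⟩
  · obtain ⟨C, hC, h⟩ := key T hT
    -- The second summand bounds the squared `L²` norm of `w`, since `|w| ≤ (1 + δ) C |y₀|` on an
    -- interval of length `T`.
    refine ⟨C + T * ((1 + δ) * C) ^ 2, by positivity, fun y₀ => ?_⟩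
    obtain ⟨v, hv, hvs, hvle, hs⟩ := h y₀
    have hvc (i : Fin M) : Continuous fun t => v t i := (hv i).continuous
    have hdc (i : Fin M) : Continuous (deriv fun t => v t i) := (hv i).continuous_deriv (by simp)
    have hwc (i : Fin M) : Continuous fun t => deriv (fun s => v s i) t + δ * v t i := by
      have := hvc i
      have := hdc i
      fun_prop
    have hwle (i : Fin M) (t : ℝ) :
        ‖deriv (fun s => v s i) t + δ * v t i‖ ≤ (1 + δ) * C * ‖y₀‖ := by
      obtain ⟨h0, h1, -⟩ := hvle i t
      refine (norm_add_le _ _).trans ?_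
      rw [norm_mul, Complex.norm_real, Real.norm_of_nonneg hδ.le]
      nlinarith
    have hvT (i : Fin M) (t : ℝ) (ht : T ≤ t) : v t i = 0 :=
      eq_zero_of_tsupport_subset_Ioo (hvs i) (by simp [ht])
    refine ⟨v, fun t i => deriv (fun s => v s i) t + δ * v t i,
      (continuous_pi hvc).continuousOn, (continuous_pi hwc).continuousOn, fun i => ?_,
      fun i t _ => eq_neg_integral_of_hasDerivAt hβe (fun s =>
        ((hv i).differentiable (by simp) s).hasDerivAt) (hdc i) (hvT i T le_rfl) t,
      fun i => ?_, fun i t ht => ⟨hvT i t ht, ?_⟩, hs.mono (by nlinarith [sq_nonneg ((1 + δ) * C)])⟩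
    · exact MeasureTheory.MemLp.of_bound (hwc i).aestronglyMeasurable _
        (Filter.Eventually.of_forall (hwle i))
    · calc ∫ t in (0 : ℝ)..T, ‖deriv (fun s => v s i) t + δ * v t i‖ ^ 2
          ≤ ∫ _ in (0 : ℝ)..T, ((1 + δ) * C * ‖y₀‖) ^ 2 :=
            intervalIntegral.integral_mono_on hT.le
              (((hwc i).norm.pow 2).intervalIntegrable _ _) intervalIntegrable_const
              fun t _ => pow_le_pow_left₀ (norm_nonneg _) (hwle i t) 2
        _ = T * ((1 + δ) * C) ^ 2 * ‖y₀‖ ^ 2 := by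
            rw [intervalIntegral.integral_const, smul_eq_mul]; ring
        _ ≤ _ := by gcongr; linarith
    · change deriv (fun s => v s i) t + δ * v t i = 0
      rw [hvT i t ht, eq_zero_of_tsupport_subset_Ioo (b := T)
        (tsupport_deriv_subset.trans (hvs i)) (by simp [ht]), mul_zero, add_zero]
  · obtain ⟨C, hC, h⟩ := key 1 one_pos
    have hexp : 1 ≤ Real.exp γ := Real.one_le_exp hγ.le
    -- Three derivatives, each at most `C |y₀|` and zero from time `1` on; before that `e^γ e^{-γt}
    -- ≥ 1`.
    refine ⟨3 * C * Real.exp γ, by positivity, fun y₀ => ?_⟩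
    obtain ⟨v, hv, hvs, hvle, hs⟩ := h y₀
    refine ⟨v, fun j => (show ContDiff ℝ 2 fun t => v t j from mod_cast contDiff_infty.1 (hv j) 2).contDiffOn, fun j t ht => ?_,
      hs.mono (by nlinarith)⟩
    rcases le_or_gt 1 t with h1 | h1
    · have hd := tsupport_deriv_subset.trans (hvs j)
      rw [eq_zero_of_tsupport_subset_Ioo (hvs j) (by simp [h1]),
        eq_zero_of_tsupport_subset_Ioo hd (by simp [h1]),
        eq_zero_of_tsupport_subset_Ioo (tsupport_deriv_subset.trans hd) (by simp [h1])]
      simp only [norm_zero, add_zero]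
      positivity
    · obtain ⟨h0, h1', h2⟩ := hvle j t
      have h3 : 1 ≤ Real.exp γ * Real.exp (-γ * t) := by
        rw [← Real.exp_add]
        exact Real.one_le_exp (by nlinarith)
      calc _ ≤ 3 * C * ‖y₀‖ * 1 := by linarith
        _ ≤ 3 * C * ‖y₀‖ * (Real.exp γ * Real.exp (-γ * t)) := by gcongr
        _ = _ := by ring
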